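/- **Setting.** There are $N$ agents with finite local state spaces $\mathcal S_i$ and finite action spaces $\mathcal A_i$, $\mathcal S=\prod_i\mathcal S_i$, $\mathcal A=\prod_i\mathcal A_i$. They have a joint transition law $P(\bar s,\bar a,\bar s')$, local rewards $r_i:\mathcal S_i\times\mathcal A_i\to\mathbb R$, a discount factor $\gamma\in(0,1)$ and stochastic policies $\pi_i$. Let $P^{\bar\pi}$ be the transition matrix on $\mathcal S$ with entries $\sum_{\bar a}P(\bar s,\bar a,\bar s')\prod_i\pi_i(s_i,a_i)$, and let $r_i^{\pi_i}(\bar s)=\sum_a\pi_i(s_i,a)r_i(s_i,a)$. Assume that $P^{\bar\pi}$ is ergodic (irreducible and aperiodic) with stationary distribution $d$, $d(\bar s)>0$ for all $\bar s$. Put $D=\mathrm{diag}(d)$. Let $\Phi\in\mathbb R^{|\mathcal S|\times q}$ have full column rank. Let $L$ be the Laplacian of a connected undirected graph on the $N$ agents. Write $\bar P=I_N\otimes P^{\bar\pi}$, $\bar D=I_N\otimes D$, $\bar\Phi=I_N\otimes\Phi$, $\bar L=L\otimes I_q$, $\bar r=(r_1^{\pi_1},\dots,r_N^{\pi_N})$,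 $\bar B=\bar\Phi^T\bar D(I-\gamma\bar P)\bar\Phi$. For $x=(\bar\theta,\bar v,\bar\mu,\bar w)\in(\mathbb R^{Nq})^4$ put $$A=\begin{bmatrix}\bar\Phi^T\bar D\bar\Phi&0&0&\bar B\\0&I&0&-\bar L\\0&0&0&-\bar L\\-\bar B^T&\bar L&\bar L&0\end{bmatrix},\qquad b=\begin{bmatrix}-\bar\Phi^T\bar D\bar r\\0\\0\\0\end{bmatrix}.$$ Let $w^*$ be the solution of the projected Bellman equation $\Pi\bigl(\tfrac1N\sum_ir_i^{\pi_i}+\gamma P^{\bar\pi}\Phi w^*\bigr)=\Phi w^*$, where $\Pi=\Phi(\Phi^TD\Phi)^{-1}\Phi^TD$. Put $\bar w^*=(w^*,\dots,w^*)$, $\bar\theta^*=(\bar\Phi^T\bar D\bar\Phi)^{-1}\bar\Phi^T\bar D(\bar r-\bar\Phi\bar w^*+\gamma\bar P\bar\Phi\bar w^*)$ and $\mathcal F=\{\bar\mu:\bar L\bar\mu=\bar\Phi^T(I-\gamma\bar P)^T\bar D\bar\Phi\bar\theta^*\}$. Let $C=C_{\bar\theta}\times C_{\bar v}\times C_{\bar\mu}\times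 C_{\bar w}$ be a product of compact boxes (products of closed bounded intervals) in $\mathbb R^{Nq}$ with $\bar\theta^*\in C_{\bar\theta}$, $0\in C_{\bar v}$, $\bar w^*\in C_{\bar w}$ and $C_{\bar\mu}\cap\mathcal F\neq\emptyset$. Assume that the box $C_{\bar v}$ is nondegenerate: in every coordinate its lower bound is strictly smaller than its upper bound. For $x\in C$ let $T_C(x)$ be the tangent cone of $C$ at $x$ and $\Gamma_{T_C(x)}$ the Euclidean projection onto it. A solution of $$\dot x=\Gamma_{T_C(x)}(-Ax-b)\qquad(\ast)$$ is a locally absolutely continuous curve $x:[0,\infty)\to C$ that satisfies $(\ast)$ for almost every $t$. **Proposition.** The set of stationary points $\mathcal H=\{x\in C:\Gamma_{T_C(x)}(-Ax-b)=0\}$ is globally asymptotically stable for $(\ast)$. That is, $\mathcal H$ is nonempty and compact, and 1. for every $x_0\in C$ there is a solution of $(\ast)$ with $x(0)=x_0$; 2. for every $\varepsilon>0$ there is $\delta>0$ such that every solution with $\mathrm{dist}(x(0),\mathcal H)<\delta$ satisfies $\mathrm{dist}(x(t),\mathcal H)<\varepsilon$ for all $t\ge0$; 3. every solution satisfies $\mathrm{dist}(x(t),\mathcal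 H)\to0$ as $t\to\infty$. -/

import Mathlib

open Set Filter Topology MeasureTheory Matrix
open scoped Kronecker

/-! ### Projected differential equations -/

section ProjectedODE

variable {E : Type*} [NormedAddCommGroup E] [InnerProductSpace ℝ E]

/-- `y` is a point of `S` nearest to `x`. -/
def IsNearestPoint (S : Set E) (x y : E) : Prop :=
  y ∈ S ∧ ∀ z ∈ S, ‖x - y‖ ≤ ‖x - z‖

/-- The projection `Γ_S(x) = argmin_{y ∈ S} ‖x - y‖` (used for nonempty closed convex `S`, where
the minimizer exists and is unique, see `isNearestPoint_projOnto`, `IsNearestPoint.unique`). -/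
noncomputable def projOnto (S : Set E) (x : E) : E :=
  Classical.epsilon (IsNearestPoint S x)

theorem isNearestPoint_projOnto [CompleteSpace E] {S : Set E} (hne : S.Nonempty)
    (hcl : IsClosed S) (hco : Convex ℝ S) (x : E) : IsNearestPoint S x (projOnto S x) := by
  apply Classical.epsilon_spec (p := IsNearestPoint S x)
  obtain ⟨v, hv, h⟩ := exists_norm_eq_iInf_of_complete_convex hne hcl.isComplete hco x
  refine ⟨v, hv, fun z hz => ?_⟩
  rw [h]
  exact ciInf_le (f := fun w : S => ‖x - w‖)
    ⟨0, by rintro _ ⟨w, rfl⟩; exact norm_nonneg _⟩ ⟨z, hz⟩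

theorem IsNearestPoint.unique {S : Set E} (hco : Convex ℝ S) {x y z : E}
    (hy : IsNearestPoint S x y) (hz : IsNearestPoint S x z) : y = z := by
  have key : ∀ {v : E}, IsNearestPoint S x v → ∀ w ∈ S, inner ℝ (x - v) (w - v) ≤ 0 := by
    intro v hv
    refine (norm_eq_iInf_iff_real_inner_le_zero hco hv.1).1 (le_antisymm ?_ ?_)
    · have : Nonempty S := ⟨⟨v, hv.1⟩⟩
      exact le_ciInf fun w => hv.2 w w.2
    · exact ciInf_le (f := fun w : S => ‖x - w‖)
        ⟨0, by rintro _ ⟨w, rfl⟩; exact norm_nonneg _⟩ ⟨v, hv.1⟩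
  have h1 := key hy z hz.1
  have h2 := key hz y hy.1
  have h3 : inner ℝ (z - y) (z - y) ≤ 0 := by
    have e : inner ℝ (z - y) (z - y) = inner ℝ (x - y) (z - y) + inner ℝ (x - z) (y - z) := by
      simp only [inner_sub_left, inner_sub_right]; ring
    linarith
  have h4 : z - y = 0 := real_inner_self_nonpos.1 h3
  exact (sub_eq_zero.1 h4).symm

/-- The projected vector field `x ↦ Γ_{T_C(x)}(f(x))`, where `T_C(x)` is the (Bouligand) tangent
cone `posTangentConeAt C x` of `C` at `x`. -/
noncomputable def projectedField (C : Set E) (f : E → E) (x : E) : E :=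
  projOnto (posTangentConeAt C x) (f x)

/-- A (Carathéodory) solution on `[0, ∞)` of `ẋ = Γ_{T_C(x)}(f(x))`: a locally absolutely
continuous curve that stays in `C` and satisfies the equation at almost every time. -/
def IsProjectedSolution (C : Set E) (f : E → E) (x : ℝ → E) : Prop :=
  (∀ t, 0 ≤ t → x t ∈ C) ∧
  (∀ T, 0 ≤ T → AbsolutelyContinuousOnInterval x 0 T) ∧
  ∀ᵐ t ∂(volume.restrict (Ici (0 : ℝ))), HasDerivAt x (projectedField C f (x t)) t

/-- The set of stationary points `{x ∈ C : Γ_{T_C(x)}(f(x)) = 0}`. -/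
def stationarySet (C : Set E) (f : E → E) : Set E :=
  {x | x ∈ C ∧ projectedField C f x = 0}

/-- The nonempty compact set `K` is globally asymptotically stable for `ẋ = Γ_{T_C(x)}(f(x))`:
every point of `C` is the initial value of a solution on `[0, ∞)`, `K` is Lyapunov stable, and
every solution converges to `K`. -/
def IsGloballyAsymptoticallyStable (C : Set E) (f : E → E) (K : Set E) : Prop :=
  K.Nonempty ∧ IsCompact K ∧
  (∀ x₀ ∈ C, ∃ x, IsProjectedSolution C f x ∧ x 0 = x₀) ∧
  (∀ ε > 0, ∃ δ > 0, ∀ x, IsProjectedSolution C f x → Metric.infDist (x 0) K < δ →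
    ∀ t, 0 ≤ t → Metric.infDist (x t) K < ε) ∧
  (∀ x, IsProjectedSolution C f x →
    Tendsto (fun t => Metric.infDist (x t) K) atTop (𝓝 0))

end ProjectedODE

/-! ### Multi-agent Markov decision processes -/

/-- A multi-agent Markov decision process with agents `Fin N`, local state spaces `S i`, local
action spaces `A i`, joint transition law `P`, local rewards `r i` and discount factor `γ`. -/
structure MultiAgentMDP (N : ℕ) (S A : Fin N → Type*) [∀ i, Fintype (S i)] where
  P : (∀ i, S i) → (∀ i, A i) → (∀ i, S i) → ℝ
  P_nonneg : ∀ s a s', 0 ≤ P s a s'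
  P_sum : ∀ s a, ∑ s', P s a s' = 1
  r : ∀ i, S i → A i → ℝ
  γ : ℝ
  γ_pos : 0 < γ
  γ_lt_one : γ < 1

/-- Stochastic policies `π i (s, a) = ℙ[a | s]` of the agents. -/
structure LocalPolicies (N : ℕ) (S A : Fin N → Type*) [∀ i, Fintype (A i)] where
  prob : ∀ i, S i → A i → ℝ
  nonneg : ∀ i s a, 0 ≤ prob i s a
  sum_eq_one : ∀ i s, ∑ a, prob i s a = 1

namespace MultiAgentMDP

variable {N : ℕ} {S A : Fin N → Type*} [∀ i, Fintype (S i)] [∀ i, Fintype (A i)]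

/-- The joint transition matrix `P^π̄` with entries
`∑_ā P(s̄, ā, s̄') ∏_i π_i(s_i, a_i)`. -/
def transitionMatrix (M : MultiAgentMDP N S A) (π : LocalPolicies N S A) :
    Matrix (∀ i, S i) (∀ i, S i) ℝ :=
  Matrix.of fun s s' => ∑ a : ∀ i, A i, M.P s a s' * ∏ i, π.prob i (s i) (a i)

/-- The expected local reward `r_i^{π_i}`, as a function of the joint state. -/
def expectedReward (M : MultiAgentMDP N S A) (π : LocalPolicies N S A) (i : Fin N)
    (s : ∀ i, S i) : ℝ :=
  ∑ a, π.prob i (s i) a * M.r i (s i) a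

end MultiAgentMDP

/-! ### The distributed gradient temporal-difference dynamics

`X` is the joint state space, `P` the transition matrix on it, `d` the stationary distribution,
`Φ` the feature matrix, `r i` the expected reward of agent `i`, `γ` the discount factor. -/

namespace DGTD

variable {N q : ℕ} {X : Type*} [Fintype X] [DecidableEq X]

/-- Index set of each of the stacked vectors `θ̄, v̄, μ̄, w̄`. -/
abbrev Idx (N q : ℕ) : Type := Fin N × Fin q

/-- The space of `x = (θ̄, v̄, μ̄, w̄)`, with the Euclidean norm; the blocks are numbered
`0, 1, 2, 3`. -/
abbrev Space (N q : ℕ) : Type := EuclideanSpace ℝ (Fin 4 × Idx N q)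

/-- The projection matrix `Π = Φ (Φᵀ D Φ)⁻¹ Φᵀ D`, `D = diag(d)`. -/
noncomputable def projMatrix (d : X → ℝ) (Φ : Matrix X (Fin q) ℝ) : Matrix X X ℝ :=
  Φ * (Φᵀ * diagonal d * Φ)⁻¹ * Φᵀ * diagonal d

/-- `w` solves the projected Bellman equation `Π((1/N) ∑ r_i + γ P Φ w) = Φ w`. -/
def SolvesProjectedBellman (γ : ℝ) (P : Matrix X X ℝ) (d : X → ℝ) (Φ : Matrix X (Fin q) ℝ)
    (r : Fin N → X → ℝ) (w : Fin q → ℝ) : Prop :=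
  projMatrix d Φ *ᵥ ((N : ℝ)⁻¹ • ∑ i, r i + γ • (P *ᵥ (Φ *ᵥ w))) = Φ *ᵥ w

/-- `P̄ = I_N ⊗ P`. -/
def barP (N : ℕ) (P : Matrix X X ℝ) : Matrix (Fin N × X) (Fin N × X) ℝ :=
  (1 : Matrix (Fin N) (Fin N) ℝ) ⊗ₖ P

/-- `D̄ = I_N ⊗ D`. -/
def barD (N : ℕ) (d : X → ℝ) : Matrix (Fin N × X) (Fin N × X) ℝ :=
  (1 : Matrix (Fin N) (Fin N) ℝ) ⊗ₖ diagonal d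

/-- `Φ̄ = I_N ⊗ Φ`. -/
def barΦ (N : ℕ) (Φ : Matrix X (Fin q) ℝ) : Matrix (Fin N × X) (Idx N q) ℝ :=
  (1 : Matrix (Fin N) (Fin N) ℝ) ⊗ₖ Φ

/-- `L̄ = L ⊗ I_q`, with `L` the graph Laplacian. -/
def barL (q : ℕ) (G : SimpleGraph (Fin N)) [DecidableRel G.Adj] :
    Matrix (Idx N q) (Idx N q) ℝ :=
  G.lapMatrix ℝ ⊗ₖ (1 : Matrix (Fin q) (Fin q) ℝ)

/-- The stacked reward vector `r̄`. -/
def barR (r : Fin N → X → ℝ) : Fin N × X → ℝ := fun p => r p.1 p.2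

/-- `B̄ = Φ̄ᵀ D̄ (I - γ P̄) Φ̄`. -/
def barB (N : ℕ) (γ : ℝ) (P : Matrix X X ℝ) (d : X → ℝ) (Φ : Matrix X (Fin q) ℝ) :
    Matrix (Idx N q) (Idx N q) ℝ :=
  (barΦ N Φ)ᵀ * barD N d * (1 - γ • barP N P) * barΦ N Φ

/-- The `4 × 4` block matrix `A` of the dynamics `ẋ = -Ax - b`. -/
def matA (G : SimpleGraph (Fin N)) [DecidableRel G.Adj] (γ : ℝ) (P : Matrix X X ℝ) (d : X → ℝ)
    (Φ : Matrix X (Fin q) ℝ) : Matrix (Fin 4 × Idx N q) (Fin 4 × Idx N q) ℝ :=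
  let blocks : Fin 4 → Fin 4 → Matrix (Idx N q) (Idx N q) ℝ :=
    ![![(barΦ N Φ)ᵀ * barD N d * barΦ N Φ, 0, 0, barB N γ P d Φ],
      ![0, 1, 0, -barL q G],
      ![0, 0, 0, -barL q G],
      ![-((barΦ N Φ)ᵀ * (1 - γ • barP N P)ᵀ * barD N d * barΦ N Φ), barL q G, barL q G, 0]]
  Matrix.of fun i j => blocks i.1 j.1 i.2 j.2

/-- The vector `b = (-Φ̄ᵀ D̄ r̄, 0, 0, 0)`. -/
def vecB (d : X → ℝ) (Φ : Matrix X (Fin q) ℝ) (r : Fin N → X → ℝ) : Fin 4 × Idx N q → ℝ :=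
  let blocks : Fin 4 → Idx N q → ℝ :=
    ![-(((barΦ N Φ)ᵀ * barD N d) *ᵥ barR r), 0, 0, 0]
  fun i => blocks i.1 i.2

/-- The affine vector field `x ↦ -Ax - b`. -/
def field (G : SimpleGraph (Fin N)) [DecidableRel G.Adj] (γ : ℝ) (P : Matrix X X ℝ) (d : X → ℝ)
    (Φ : Matrix X (Fin q) ℝ) (r : Fin N → X → ℝ) (x : Space N q) : Space N q :=
  WithLp.toLp 2 (-(matA G γ P d Φ *ᵥ WithLp.ofLp x) - vecB d Φ r)

/-- The stacked vector `w̄ = (w, …, w)`. -/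
def stack (N : ℕ) (w : Fin q → ℝ) : Idx N q → ℝ := fun p => w p.2

/-- `θ̄* = (Φ̄ᵀ D̄ Φ̄)⁻¹ Φ̄ᵀ D̄ (r̄ - Φ̄ w̄ + γ P̄ Φ̄ w̄)`, where `w̄ = (w, …, w)`. -/
noncomputable def thetaStar (γ : ℝ) (P : Matrix X X ℝ) (d : X → ℝ) (Φ : Matrix X (Fin q) ℝ)
    (r : Fin N → X → ℝ) (w : Fin q → ℝ) : Idx N q → ℝ :=
  ((barΦ N Φ)ᵀ * barD N d * barΦ N Φ)⁻¹ *ᵥ (((barΦ N Φ)ᵀ * barD N d) *ᵥ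
    (barR r - barΦ N Φ *ᵥ stack N w + γ • (barP N P *ᵥ (barΦ N Φ *ᵥ stack N w))))

/-- The solution set `𝓕 = {μ̄ : L̄ μ̄ = Φ̄ᵀ (I - γ P̄)ᵀ D̄ Φ̄ θ̄}`. -/
def setF (G : SimpleGraph (Fin N)) [DecidableRel G.Adj] (γ : ℝ) (P : Matrix X X ℝ) (d : X → ℝ)
    (Φ : Matrix X (Fin q) ℝ) (θ : Idx N q → ℝ) : Set (Idx N q → ℝ) :=
  {μ | barL q G *ᵥ μ = ((barΦ N Φ)ᵀ * (1 - γ • barP N P)ᵀ * barD N d * barΦ N Φ) *ᵥ θ}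

/-- The product `C = C_θ × C_v × C_μ × C_w`. -/
def constraintSet (Cθ Cv Cμ Cw : Set (Idx N q → ℝ)) : Set (Space N q) :=
  {x | (fun a => x (0, a)) ∈ Cθ ∧ (fun a => x (1, a)) ∈ Cv ∧
    (fun a => x (2, a)) ∈ Cμ ∧ (fun a => x (3, a)) ∈ Cw}

end DGTD

/-! Write `f(x) = -Ax - b` and `G = Φ̄ᵀD̄Φ̄`, which is positive definite. The off-diagonal blocks of
`A` form a skew matrix, so `⟨x - y, f x - f y⟩ = -Δθᵀ G Δθ - |Δv|² ≤ 0` (`inner_saddleField_sub`).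
Projecting onto the tangent cone of the box only removes an outward normal, hence the distance
between two solutions never increases (`antitoneOn_dist`). Stationary points are constant solutions.
Lyapunov stability therefore holds with `δ = ε`, and for convergence it is enough that every
solution accumulates at some stationary point.

The dissipation sees only `θ` and `v`, so a LaSalle argument is iterated. By contraction, an
accumulation point of a solution starts a limit solution along which each continuous quantity that
converged is frozen at its limit (`exists_limit_solution`). On a first limit solution the distance
to the zero `e = (θ*, 0, μ, w*)` of `f` is frozen, so `θ = θ*` and `v = 0`. Since `v` rests at `0`,
the projection of `(Lw)_a` at `0` in the `v`-interval vanishes. That interval is nondegenerate, so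
`(Lw)_a` keeps one sign. It also drives `μ_a`, which is therefore monotone and converges. On a
second limit solution `θ, v, μ` are frozen, the field in `w` is constant, and `w` is monotone. A
third limit solution is constant, hence stationary.

Existence comes from the projected Euler scheme. Its limit is a Lipschitz curve with `⟨ẋ - f(x), x -
z⟩ ≤ 0` for all `z` in the box, and for a curve that stays in the box this determines `ẋ`. -/

/-! ### Projection onto the tangent cone of a box -/

/-- The projection of `v` onto the tangent cone of the interval `[l, u]` at its point `x`. -/
noncomputable def intervalProj (l u x v : ℝ) : ℝ :=
  if x = l then (if x = u then 0 else max v 0) else if x = u then min v 0 else v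

/-- What the projection removes from `v` is an outward normal of the interval at `x`. -/
theorem intervalProj_mul_nonneg {l u z : ℝ} (x v : ℝ) (hz : z ∈ Icc l u) :
    0 ≤ (v - intervalProj l u x v) * (x - z) := by
  unfold intervalProj
  split_ifs with h1 h2 h2
  · have : x - z = 0 := by linarith [hz.1, hz.2]
    simp [this]
  · exact mul_nonneg_of_nonpos_of_nonpos (by linarith [le_max_left v 0]) (by linarith [hz.1])
  · exact mul_nonneg (by linarith [min_le_left v 0]) (by linarith [hz.2])
  · simp

theorem intervalProj_nonneg (l u x : ℝ) {v : ℝ} (hv : 0 ≤ v) : 0 ≤ intervalProj l u x v := by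
  unfold intervalProj
  split_ifs <;> simp [hv]

theorem intervalProj_nonpos (l u x : ℝ) {v : ℝ} (hv : v ≤ 0) : intervalProj l u x v ≤ 0 := by
  unfold intervalProj
  split_ifs <;> simp [hv]

theorem nonpos_of_intervalProj_eq_zero {l u x v : ℝ} (hx : x < u)
    (h : intervalProj l u x v = 0) : v ≤ 0 := by
  unfold intervalProj at h
  split_ifs at h with h1 h2 h2
  · exact absurd h2 hx.ne
  · simpa using h
  · exact absurd h2 hx.ne
  · exact h.le

theorem nonneg_of_intervalProj_eq_zero {l u x v : ℝ} (hx : l < x)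
    (h : intervalProj l u x v = 0) : 0 ≤ v := by
  unfold intervalProj at h
  split_ifs at h with h1 h2 h2
  · exact absurd h1 hx.ne'
  · exact absurd h1 hx.ne'
  · simpa using h
  · exact h.ge

/-- The variational inequality is a closed condition on `x` and `v`, whereas `intervalProj` jumps at
the endpoints. This makes the stationary set closed. -/
theorem intervalProj_eq_zero_iff {l u x v : ℝ} (hx : x ∈ Icc l u) :
    intervalProj l u x v = 0 ↔ ∀ z ∈ Icc l u, v * (z - x) ≤ 0 := by
  constructor
  · intro h z hz
    have := intervalProj_mul_nonneg x v hz
    rw [h] at this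
    linarith
  · intro h
    have hl := h l ⟨le_rfl, hx.1.trans hx.2⟩
    have hu := h u ⟨hx.1.trans hx.2, le_rfl⟩
    unfold intervalProj
    have h1 : x ≠ l → 0 ≤ v := fun hne => by
      have : l < x := lt_of_le_of_ne hx.1 hne.symm
      by_contra hv
      nlinarith
    have h2 : x ≠ u → v ≤ 0 := fun hne => by
      have : x < u := lt_of_le_of_ne hx.2 hne
      by_contra hv
      nlinarith
    split_ifs with h3 h4 h4
    · rfl
    · exact max_eq_right (h2 h4)
    · exact min_eq_right (h1 h3)
    · exact le_antisymm (h2 h4) (h1 h3)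

/-- A derivative `p` of a curve in `[l, u]` that differs from `v` by a normal vector is the
projection of `v`. -/
theorem eq_intervalProj {l u x v p : ℝ} (hx : x ∈ Icc l u) (hl : x = l → p = 0)
    (hu : x = u → p = 0) (h : ∀ z ∈ Icc l u, (p - v) * (x - z) ≤ 0) :
    p = intervalProj l u x v := by
  have h1 := h l ⟨le_rfl, hx.1.trans hx.2⟩
  have h2 := h u ⟨hx.1.trans hx.2, le_rfl⟩
  have hge : x ≠ l → p ≤ v := fun hne => by
    have : l < x := lt_of_le_of_ne hx.1 hne.symm
    by_contra hv
    nlinarith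
  have hle : x ≠ u → v ≤ p := fun hne => by
    have : x < u := lt_of_le_of_ne hx.2 hne
    by_contra hv
    nlinarith
  unfold intervalProj
  split_ifs with h3 h4 h4
  · exact hl h3
  · have := hl h3; have := hle h4
    rw [max_eq_right] <;> linarith
  · have := hu h4; have := hge h3
    rw [min_eq_right] <;> linarith
  · exact le_antisymm (hge h3) (hle h4)

/-! ### Tangent cone and projected field of a box -/

section Box

variable {ι : Type*}

/-- The box `∏ [l i, u i]` in Euclidean space. -/
def euclideanBox (l u : ι → ℝ) : Set (EuclideanSpace ℝ ι) :=
  {x | ∀ i, x i ∈ Icc (l i) (u i)}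

theorem convex_euclideanBox (l u : ι → ℝ) : Convex ℝ (euclideanBox l u) := by
  intro x hx y hy a b ha hb hab i
  exact convex_Icc (l i) (u i) (hx i) (hy i) ha hb hab

theorem isCompact_euclideanBox (l u : ι → ℝ) : IsCompact (euclideanBox l u) := by
  have : euclideanBox l u = (EuclideanSpace.equiv ι ℝ).symm '' Icc l u := by
    ext x
    constructor
    · intro hx
      exact ⟨EuclideanSpace.equiv ι ℝ x, ⟨fun i => (hx i).1, fun i => (hx i).2⟩, by simp⟩
    · rintro ⟨y, hy, rfl⟩ i
      exact ⟨hy.1 i, hy.2 i⟩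
  rw [this]
  exact isCompact_Icc.image (EuclideanSpace.equiv ι ℝ).symm.continuous

variable [Fintype ι]

/-- An active constraint makes the coordinate extremal on the box, which fixes the sign of its
derivative along tangent directions. Conversely, a direction with these signs stays in the box for a
short time. -/
theorem mem_posTangentConeAt_euclideanBox {l u : ι → ℝ} {x : EuclideanSpace ℝ ι}
    (hx : x ∈ euclideanBox l u) (y : EuclideanSpace ℝ ι) :
    y ∈ posTangentConeAt (euclideanBox l u) x ↔
      ∀ i, (x i = l i → 0 ≤ y i) ∧ (x i = u i → y i ≤ 0) := by
  constructor
  · intro hy i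
    have hd := (EuclideanSpace.proj (𝕜 := ℝ) i).hasFDerivWithinAt
      (s := euclideanBox l u) (x := x)
    constructor
    · intro h
      refine IsLocalMinOn.hasFDerivWithinAt_nonneg (IsMinOn.localize ?_) hd hy
      intro z hz
      simpa [h] using (hz i).1
    · intro h
      refine IsLocalMaxOn.hasFDerivWithinAt_nonpos (IsMaxOn.localize ?_) hd hy
      intro z hz
      simpa [h] using (hz i).2
  · intro h
    apply mem_posTangentConeAt_of_frequently_mem
    apply Eventually.frequently
    refine eventually_all.2 fun i => ?_
    have hc : Tendsto (fun t : ℝ => x i + t * y i) (𝓝[>] 0) (𝓝 (x i)) := by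
      have : Tendsto (fun t : ℝ => x i + t * y i) (𝓝 0) (𝓝 (x i + 0 * y i)) :=
        Continuous.tendsto (by fun_prop) 0
      simpa using this.mono_left nhdsWithin_le_nhds
    have h1 : ∀ᶠ t in 𝓝[>] (0 : ℝ), l i ≤ x i + t * y i := by
      rcases (hx i).1.eq_or_lt with e | e
      · filter_upwards [self_mem_nhdsWithin] with t ht
        have := mul_nonneg (le_of_lt ht) ((h i).1 e.symm)
        linarith
      · exact (hc.eventually (lt_mem_nhds e)).mono fun _ => le_of_lt
    have h2 : ∀ᶠ t in 𝓝[>] (0 : ℝ), x i + t * y i ≤ u i := by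
      rcases (hx i).2.eq_or_lt with e | e
      · filter_upwards [self_mem_nhdsWithin] with t ht
        have := mul_nonpos_of_nonneg_of_nonpos (le_of_lt ht) ((h i).2 e)
        linarith
      · exact (hc.eventually (gt_mem_nhds e)).mono fun _ => le_of_lt
    filter_upwards [h1, h2] with t a b
    exact ⟨a, b⟩

theorem abs_sub_intervalProj_le {l u x z v : ℝ} (hl : x = l → 0 ≤ z) (hu : x = u → z ≤ 0) :
    |v - intervalProj l u x v| ≤ |v - z| := by
  unfold intervalProj
  split_ifs with h1 h2 h2
  · rw [le_antisymm (hu h2) (hl h1)]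
  · have := hl h1
    rcases le_total v 0 with hv | hv
    · rw [max_eq_right hv, abs_of_nonpos (by linarith), abs_of_nonpos (by linarith)]; linarith
    · simp [hv]
  · have := hu h2
    rcases le_total v 0 with hv | hv
    · simp [hv]
    · rw [min_eq_right hv, abs_of_nonneg (by linarith), abs_of_nonneg (by linarith)]; linarith
  · simp

/-- The tangent cone is a product of cones in `ℝ`, so the nearest point is found coordinate by
coordinate; uniqueness identifies it with the chosen one. -/
theorem projectedField_euclideanBox_apply {l u : ι → ℝ} {x : EuclideanSpace ℝ ι}
    (hx : x ∈ euclideanBox l u) (f : EuclideanSpace ℝ ι → EuclideanSpace ℝ ι) (i : ι) :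
    projectedField (euclideanBox l u) f x i = intervalProj (l i) (u i) (x i) (f x i) := by
  set T := posTangentConeAt (euclideanBox l u) x with hT
  set p : EuclideanSpace ℝ ι :=
    WithLp.toLp 2 fun i => intervalProj (l i) (u i) (x i) (f x i) with hp
  have hco : Convex ℝ T := by
    intro a ha b hb s t hs ht _
    rw [mem_posTangentConeAt_euclideanBox hx] at ha hb ⊢
    refine fun i => ⟨fun e => ?_, fun e => ?_⟩
    · have := mul_nonneg hs ((ha i).1 e)
      have := mul_nonneg ht ((hb i).1 e)
      simpa using by linarith
    · have := mul_nonpos_of_nonneg_of_nonpos hs ((ha i).2 e)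
      have := mul_nonpos_of_nonneg_of_nonpos ht ((hb i).2 e)
      simpa using by linarith
  have hnear : IsNearestPoint T (f x) p := by
    constructor
    · rw [mem_posTangentConeAt_euclideanBox hx]
      refine fun i => ⟨fun e => ?_, fun e => ?_⟩
      · simp only [hp, intervalProj, if_pos e]
        split_ifs <;> simp
      · simp only [hp, intervalProj, if_pos e]
        split_ifs <;> simp
    · intro z hz
      rw [mem_posTangentConeAt_euclideanBox hx] at hz
      rw [EuclideanSpace.norm_eq, EuclideanSpace.norm_eq]
      refine Real.sqrt_le_sqrt (Finset.sum_le_sum fun i _ => ?_)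
      exact pow_le_pow_left₀ (norm_nonneg _) (abs_sub_intervalProj_le (hz i).1 (hz i).2) 2
  have : projectedField (euclideanBox l u) f x = p :=
    IsNearestPoint.unique hco (Classical.epsilon_spec ⟨p, hnear⟩) hnear
  rw [this]

theorem mem_stationarySet_euclideanBox {l u : ι → ℝ}
    {f : EuclideanSpace ℝ ι → EuclideanSpace ℝ ι} {x : EuclideanSpace ℝ ι} :
    x ∈ stationarySet (euclideanBox l u) f ↔
      x ∈ euclideanBox l u ∧ ∀ i, ∀ z ∈ Icc (l i) (u i), f x i * (z - x i) ≤ 0 := by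
  refine and_congr_right fun hx => ?_
  rw [PiLp.ext_iff]
  refine forall_congr' fun i => ?_
  rw [projectedField_euclideanBox_apply hx]
  exact intervalProj_eq_zero_iff (hx i)

theorem isCompact_stationarySet_euclideanBox (l u : ι → ℝ)
    {f : EuclideanSpace ℝ ι → EuclideanSpace ℝ ι} (hf : Continuous f) :
    IsCompact (stationarySet (euclideanBox l u) f) := by
  have : stationarySet (euclideanBox l u) f = euclideanBox l u ∩
      {x | ∀ i, ∀ z ∈ Icc (l i) (u i), f x i * (z - x i) ≤ 0} := by
    ext x; exact mem_stationarySet_euclideanBox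
  rw [this]
  refine (isCompact_euclideanBox l u).inter_right ?_
  simp only [ofPred_forall]
  refine isClosed_iInter fun i => isClosed_iInter fun z => isClosed_iInter fun _ => ?_
  exact isClosed_le (by fun_prop) continuous_const

theorem mem_stationarySet_of_eq_zero {l u : ι → ℝ}
    {f : EuclideanSpace ℝ ι → EuclideanSpace ℝ ι} {x : EuclideanSpace ℝ ι}
    (hx : x ∈ euclideanBox l u) (h : f x = 0) : x ∈ stationarySet (euclideanBox l u) f :=
  mem_stationarySet_euclideanBox.2 ⟨hx, fun i z _ => by simp [h]⟩

/-- The defect `f x - Γ(f x)` is a normal vector of the box. -/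
theorem inner_projectedField_le {l u : ι → ℝ} {x z : EuclideanSpace ℝ ι}
    (hx : x ∈ euclideanBox l u) (hz : z ∈ euclideanBox l u)
    (f : EuclideanSpace ℝ ι → EuclideanSpace ℝ ι) :
    inner ℝ (x - z) (projectedField (euclideanBox l u) f x) ≤ inner ℝ (x - z) (f x) := by
  simp only [PiLp.inner_apply]
  refine Finset.sum_le_sum fun i _ => ?_
  rw [projectedField_euclideanBox_apply hx]
  have := intervalProj_mul_nonneg (x i) (f x i) (hz i)
  simp only [PiLp.sub_apply, RCLike.inner_apply, conj_trivial]
  nlinarith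

end Box

/-! ### Absolutely continuous functions -/

section AbsolutelyContinuous

theorem AbsolutelyContinuousOnInterval.of_dist_le {X Y : Type*} [PseudoMetricSpace X]
    [PseudoMetricSpace Y] {f : ℝ → X} {g : ℝ → Y} {a b : ℝ}
    (hf : AbsolutelyContinuousOnInterval f a b)
    (h : ∀ s t, dist (g s) (g t) ≤ dist (f s) (f t)) : AbsolutelyContinuousOnInterval g a b :=
  squeeze_zero (fun _ => Finset.sum_nonneg fun _ _ => dist_nonneg)
    (fun _ => Finset.sum_le_sum fun _ _ => h _ _) hf

theorem AbsolutelyContinuousOnInterval.comp_const_add {X : Type*} [PseudoMetricSpace X]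
    {f : ℝ → X} {a b : ℝ} (s : ℝ) (hf : AbsolutelyContinuousOnInterval f (s + a) (s + b)) :
    AbsolutelyContinuousOnInterval (fun t => f (s + t)) a b := by
  rw [absolutelyContinuousOnInterval_iff] at hf ⊢
  intro ε hε
  obtain ⟨δ, hδ, h⟩ := hf ε hε
  refine ⟨δ, hδ, fun E hE hlt => ?_⟩
  refine h (E.1, fun i => (s + (E.2 i).1, s + (E.2 i).2)) ⟨fun i hi => ?_, fun i hi j hj hij => ?_⟩
    (by simpa using hlt)
  · have := hE.1 i hi
    simp only [mem_uIcc] at this ⊢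
    constructor
    · rcases this.1 with h | h
      · left; constructor <;> linarith [h.1, h.2]
      · right; constructor <;> linarith [h.1, h.2]
    · rcases this.2 with h | h
      · left; constructor <;> linarith [h.1, h.2]
      · right; constructor <;> linarith [h.1, h.2]
  · have := hE.2 hi hj hij
    simp only [Function.onFun, Set.disjoint_left, mem_uIoc] at this ⊢
    intro t ht ht'
    refine this (a := t - s) ?_ ?_
    · rcases ht with h | h
      · left; constructor <;> linarith [h.1, h.2]
      · right; constructor <;> linarith [h.1, h.2]
    · rcases ht' with h | h
      · left; constructor <;> linarith [h.1, h.2]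
      · right; constructor <;> linarith [h.1, h.2]

/-- Absolute continuity gives the fundamental theorem of calculus, without which an a.e. sign of the
derivative says nothing. -/
theorem antitoneOn_of_ae_deriv_nonpos {g : ℝ → ℝ}
    (hg : ∀ T, 0 ≤ T → AbsolutelyContinuousOnInterval g 0 T)
    (h : ∀ᵐ t ∂(volume.restrict (Ici (0 : ℝ))), deriv g t ≤ 0) : AntitoneOn g (Ici 0) := by
  intro s hs t ht hst
  have hac : AbsolutelyContinuousOnInterval g s t := (hg t ht).mono (by
    rw [uIcc_of_le hst, uIcc_of_le (mem_Ici.1 ht)]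
    exact Icc_subset_Icc_left hs)
  have hint := hac.integral_deriv_eq_sub
  have : 0 ≤ ∫ x in s..t, -deriv g x := by
    refine intervalIntegral.integral_nonneg_of_ae_restrict hst ?_
    have := ae_restrict_of_ae_restrict_of_subset
      (show Icc s t ⊆ Ici 0 from fun x hx => le_trans hs hx.1) h
    filter_upwards [this] with x hx
    simpa using hx
  rw [intervalIntegral.integral_neg, hint] at this
  linarith

theorem monotoneOn_of_ae_deriv_nonneg {g : ℝ → ℝ}
    (hg : ∀ T, 0 ≤ T → AbsolutelyContinuousOnInterval g 0 T)
    (h : ∀ᵐ t ∂(volume.restrict (Ici (0 : ℝ))), 0 ≤ deriv g t) : MonotoneOn g (Ici 0) := by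
  have := antitoneOn_of_ae_deriv_nonpos (g := -g) (fun T hT => (hg T hT).neg) (by
    filter_upwards [h] with t ht
    simpa [deriv.neg] using ht)
  intro s hs t ht hst
  simpa using this hs ht hst

theorem eqOn_Ici_of_ae_eq {Y : Type*} [TopologicalSpace Y] [T2Space Y] {f g : ℝ → Y}
    (h : ∀ᵐ t ∂(volume.restrict (Ici (0 : ℝ))), f t = g t) (hf : ContinuousOn f (Ici 0))
    (hg : ContinuousOn g (Ici 0)) : EqOn f g (Ici 0) :=
  Measure.eqOn_of_ae_eq h hf hg (by simp)

theorem ae_const_add_of_ae_Ici {p : ℝ → Prop} (h : ∀ᵐ t ∂(volume.restrict (Ici (0 : ℝ))), p t)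
    {s : ℝ} (hs : 0 ≤ s) : ∀ᵐ t ∂(volume.restrict (Ici (0 : ℝ))), p (s + t) := by
  rw [ae_restrict_iff' measurableSet_Ici] at h ⊢
  have := (measurePreserving_add_left volume s).quasiMeasurePreserving.ae h
  filter_upwards [this] with t ht h0
  exact ht (add_nonneg hs h0)

end AbsolutelyContinuous

/-! ### Solutions of a projected equation -/

namespace IsProjectedSolution

section General

variable {E : Type*} [NormedAddCommGroup E] [InnerProductSpace ℝ E] {C : Set E} {f : E → E}
  {x : ℝ → E}

theorem comp_const_add (hx : IsProjectedSolution C f x) {s : ℝ} (hs : 0 ≤ s) :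
    IsProjectedSolution C f (fun t => x (s + t)) := by
  refine ⟨fun t ht => hx.1 _ (add_nonneg hs ht), fun T hT => ?_, ?_⟩
  · refine AbsolutelyContinuousOnInterval.comp_const_add s
      ((hx.2.1 (s + T) (add_nonneg hs hT)).mono ?_)
    rw [uIcc_of_le (by linarith), uIcc_of_le (by linarith), add_zero]
    exact Icc_subset_Icc_left hs
  · filter_upwards [ae_const_add_of_ae_Ici hx.2.2 hs] with t ht
    exact ht.comp_const_add s t

theorem continuousOn (hx : IsProjectedSolution C f x) : ContinuousOn x (Ici 0) := by
  intro t ht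
  have h0 : (0 : ℝ) ≤ t := ht
  have h := (hx.2.1 (t + 1) (by linarith)).continuousOn
  rw [uIcc_of_le (by linarith)] at h
  refine (h t ⟨h0, by linarith⟩).mono_of_mem_nhdsWithin ?_
  filter_upwards [self_mem_nhdsWithin, mem_nhdsWithin_of_mem_nhds (Iio_mem_nhds (lt_add_one t))]
    with s hs hs'
  exact ⟨hs, le_of_lt hs'⟩

theorem const {c : E} (hc : c ∈ stationarySet C f) : IsProjectedSolution C f (fun _ => c) := by
  refine ⟨fun t _ => hc.1, fun T _ => ?_, ?_⟩
  · exact (LipschitzWith.const c).lipschitzOnWith.absolutelyContinuousOnInterval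
  · refine Eventually.of_forall fun t => ?_
    rw [hc.2]
    exact hasDerivAt_const _ _

/-- The value of a constant solution is stationary. -/
theorem mem_stationarySet_of_const {c : E} (hx : IsProjectedSolution C f x)
    (hc : ∀ t, 0 ≤ t → x t = c) : c ∈ stationarySet C f := by
  refine ⟨hc 0 le_rfl ▸ hx.1 0 le_rfl, ?_⟩
  have h : ∀ᵐ t ∂(volume.restrict (Ioi (0 : ℝ))), projectedField C f c = 0 := by
    have h1 := ae_restrict_of_ae_restrict_of_subset Ioi_subset_Ici_self hx.2.2
    filter_upwards [h1, ae_restrict_mem measurableSet_Ioi] with t ht h0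
    have h2 : HasDerivAt x 0 t := by
      refine (hasDerivAt_const t c).congr_of_eventuallyEq ?_
      filter_upwards [Ioi_mem_nhds h0] with s hs
      exact hc s (le_of_lt hs)
    rw [hc t (le_of_lt h0)] at ht
    exact ht.unique h2
  have : NeBot (ae (volume.restrict (Ioi (0 : ℝ)))) := by
    rw [ae_neBot, Ne, Measure.restrict_eq_zero]
    simp
  exact h.exists.choose_spec

end General

/-! ### Contraction between solutions, and limit solutions -/

section Box

variable {ι : Type*} [Fintype ι] {l u : ι → ℝ}
  {f : EuclideanSpace ℝ ι → EuclideanSpace ℝ ι} {x y : ℝ → EuclideanSpace ℝ ι}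

theorem absolutelyContinuousOnInterval_apply (hx : IsProjectedSolution (euclideanBox l u) f x)
    (i : ι) {T : ℝ} (hT : 0 ≤ T) : AbsolutelyContinuousOnInterval (fun t => x t i) 0 T :=
  (hx.2.1 T hT).of_dist_le fun s t => by
    rw [dist_eq_norm, dist_eq_norm]
    exact PiLp.norm_apply_le (x s - x t) i

theorem ae_hasDerivAt_apply (hx : IsProjectedSolution (euclideanBox l u) f x) :
    ∀ᵐ t ∂(volume.restrict (Ici (0 : ℝ))), ∀ i,
      HasDerivAt (fun s => x s i) (intervalProj (l i) (u i) (x t i) (f (x t) i)) t := by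
  filter_upwards [hx.2.2, ae_restrict_mem measurableSet_Ici] with t ht h0 i
  rw [← projectedField_euclideanBox_apply (hx.1 t h0) f i]
  exact (EuclideanSpace.proj (𝕜 := ℝ) i).hasFDerivAt.comp_hasDerivAt t ht

/-- The derivative is `2⟨x - y, Γf(x) - Γf(y)⟩`. Testing the normal at `x` with `y` and the normal
at `y` with `x` bounds it by the same expression without `Γ`. -/
theorem antitoneOn_norm_sub_sq
    (hmono : ∀ a ∈ euclideanBox l u, ∀ b ∈ euclideanBox l u, inner ℝ (a - b) (f a - f b) ≤ 0)
    (hx : IsProjectedSolution (euclideanBox l u) f x)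
    (hy : IsProjectedSolution (euclideanBox l u) f y) :
    AntitoneOn (fun t => ‖x t - y t‖ ^ 2) (Ici 0) := by
  refine antitoneOn_of_ae_deriv_nonpos (fun T hT => ?_) ?_
  · have h1 : AbsolutelyContinuousOnInterval (fun t => ‖x t - y t‖) 0 T :=
      ((hx.2.1 T hT).sub (hy.2.1 T hT)).of_dist_le fun s t => by
        simpa [dist_eq_norm] using abs_norm_sub_norm_le (x s - y s) (x t - y t)
    simpa [sq] using h1.fun_mul h1
  · filter_upwards [hx.2.2, hy.2.2, ae_restrict_mem measurableSet_Ici] with t hxt hyt h0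
    have hxC := hx.1 t h0
    have hyC := hy.1 t h0
    rw [(hxt.fun_sub hyt).norm_sq.deriv]
    have h1 := inner_projectedField_le hxC hyC f
    have h2 := inner_projectedField_le hyC hxC f
    have h3 := hmono _ hxC _ hyC
    simp only [inner_sub_right] at h1 h2 h3 ⊢
    rw [← neg_sub (x t) (y t), inner_neg_left, inner_neg_left] at h2
    linarith

theorem antitoneOn_dist
    (hmono : ∀ a ∈ euclideanBox l u, ∀ b ∈ euclideanBox l u, inner ℝ (a - b) (f a - f b) ≤ 0)
    (hx : IsProjectedSolution (euclideanBox l u) f x)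
    (hy : IsProjectedSolution (euclideanBox l u) f y) :
    AntitoneOn (fun t => dist (x t) (y t)) (Ici 0) := by
  intro s hs t ht hst
  have := antitoneOn_norm_sub_sq hmono hx hy hs ht hst
  simp only [dist_eq_norm]
  exact le_of_sq_le_sq this (norm_nonneg _)

theorem antitoneOn_dist_stationary
    (hmono : ∀ a ∈ euclideanBox l u, ∀ b ∈ euclideanBox l u, inner ℝ (a - b) (f a - f b) ≤ 0)
    (hx : IsProjectedSolution (euclideanBox l u) f x) {h : EuclideanSpace ℝ ι}
    (hh : h ∈ stationarySet (euclideanBox l u) f) :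
    AntitoneOn (fun t => dist (x t) h) (Ici 0) :=
  antitoneOn_dist hmono hx (const hh)

/-- The curves `x (s + ·)` accumulate at a solution as `s → ∞`. -/
theorem exists_limit_solution
    (hmono : ∀ a ∈ euclideanBox l u, ∀ b ∈ euclideanBox l u, inner ℝ (a - b) (f a - f b) ≤ 0)
    (hex : ∀ x₀ ∈ euclideanBox l u, ∃ x, IsProjectedSolution (euclideanBox l u) f x ∧ x 0 = x₀)
    (hx : IsProjectedSolution (euclideanBox l u) f x) :
    ∃ y, IsProjectedSolution (euclideanBox l u) f y ∧
      (∀ t, 0 ≤ t → y t ∈ closure (x '' Ici 0)) ∧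
      ∀ (φ : EuclideanSpace ℝ ι → ℝ) (c : ℝ), Continuous φ →
        Tendsto (fun t => φ (x t)) atTop (𝓝 c) → ∀ t, 0 ≤ t → φ (y t) = c := by
  -- Along an ultrafilter finer than `atTop`, compactness yields a limit without choosing a sequence
  -- of times.
  set U : Ultrafilter ℝ := Ultrafilter.of atTop
  have hU : (U : Filter ℝ) ≤ atTop := Ultrafilter.of_le atTop
  have hpos : ∀ᶠ s in (U : Filter ℝ), 0 ≤ s := hU (eventually_ge_atTop 0)
  obtain ⟨y₀, hy₀, hle⟩ := (isCompact_euclideanBox l u).ultrafilter_le_nhds (U.map x)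
    (le_principal_iff.2 (hpos.mono fun s hs => hx.1 s hs))
  obtain ⟨y, hy, hy0⟩ := hex y₀ hy₀
  -- Contraction carries convergence of the initial values `x s → y 0` to every later time.
  have hconv : ∀ t, 0 ≤ t → Tendsto (fun s => x (s + t)) U (𝓝 (y t)) := by
    intro t ht
    have hlim : Tendsto x (U : Filter ℝ) (𝓝 y₀) := hle
    rw [tendsto_iff_dist_tendsto_zero] at hlim ⊢
    refine squeeze_zero' (Eventually.of_forall fun _ => dist_nonneg) ?_ hlim
    filter_upwards [hpos] with s hs
    have := antitoneOn_dist hmono (hx.comp_const_add hs) hy (mem_Ici.2 le_rfl) (mem_Ici.2 ht) ht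
    simpa [hy0] using this
  refine ⟨y, hy, fun t ht => ?_, fun φ c hφ hc t ht => ?_⟩
  · refine mem_closure_of_tendsto (hconv t ht) ?_
    filter_upwards [hpos] with s hs
    exact ⟨s + t, add_nonneg hs ht, rfl⟩
  · refine tendsto_nhds_unique ((hφ.tendsto _).comp (hconv t ht)) ?_
    exact hc.comp ((tendsto_atTop_add_const_right _ t tendsto_id).mono_left hU)

end Box

end IsProjectedSolution

/-! ### Existence of solutions by the projected Euler scheme -/

section Euler

variable {E : Type*} [NormedAddCommGroup E] [InnerProductSpace ℝ E] {C : Set E} {f : E → E}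

theorem IsNearestPoint.inner_le {S : Set E} (hco : Convex ℝ S) {x y : E}
    (hy : IsNearestPoint S x y) : ∀ w ∈ S, inner ℝ (x - y) (w - y) ≤ 0 := by
  refine (norm_eq_iInf_iff_real_inner_le_zero hco hy.1).1 (le_antisymm ?_ ?_)
  · have : Nonempty S := ⟨⟨y, hy.1⟩⟩
    exact le_ciInf fun w => hy.2 w w.2
  · exact ciInf_le (f := fun w : S => ‖x - w‖)
      ⟨0, by rintro _ ⟨w, rfl⟩; exact norm_nonneg _⟩ ⟨y, hy.1⟩

/-- The projected Euler scheme with step size `h`. -/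
noncomputable def projectedEuler (C : Set E) (f : E → E) (h : ℝ) (x₀ : E) : ℕ → E
  | 0 => x₀
  | n + 1 => projOnto C (projectedEuler C f h x₀ n + h • f (projectedEuler C f h x₀ n))

variable [CompleteSpace E]

theorem isNearestPoint_projectedEuler_succ (hcl : IsClosed C) (hco : Convex ℝ C) {x₀ : E}
    (hx₀ : x₀ ∈ C) (h : ℝ) (n : ℕ) :
    IsNearestPoint C (projectedEuler C f h x₀ n + h • f (projectedEuler C f h x₀ n))
      (projectedEuler C f h x₀ (n + 1)) :=
  isNearestPoint_projOnto ⟨x₀, hx₀⟩ hcl hco _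

theorem projectedEuler_mem (hcl : IsClosed C) (hco : Convex ℝ C) {x₀ : E} (hx₀ : x₀ ∈ C) (h : ℝ) :
    ∀ n, projectedEuler C f h x₀ n ∈ C
  | 0 => hx₀
  | n + 1 => (isNearestPoint_projectedEuler_succ hcl hco hx₀ h n).1

theorem norm_projectedEuler_defect_le (hcl : IsClosed C) (hco : Convex ℝ C) {x₀ : E}
    (hx₀ : x₀ ∈ C) {h M : ℝ} (hh : 0 ≤ h) (hM : ∀ x ∈ C, ‖f x‖ ≤ M) (n : ℕ) :
    ‖projectedEuler C f h x₀ n + h • f (projectedEuler C f h x₀ n) -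
      projectedEuler C f h x₀ (n + 1)‖ ≤ h * M := by
  have hn := projectedEuler_mem (f := f) hcl hco hx₀ h n
  refine ((isNearestPoint_projectedEuler_succ hcl hco hx₀ h n).2 _ hn).trans ?_
  rw [add_sub_cancel_left, norm_smul, Real.norm_of_nonneg hh]
  exact mul_le_mul_of_nonneg_left (hM _ hn) hh

/-- Each step moves by at most `2hM`: `hM` for the Euler increment and `hM` for the projection back
to `C`. -/
theorem norm_projectedEuler_add_sub_le (hcl : IsClosed C) (hco : Convex ℝ C) {x₀ : E}
    (hx₀ : x₀ ∈ C) {h M : ℝ} (hh : 0 ≤ h) (hM : ∀ x ∈ C, ‖f x‖ ≤ M) (k n : ℕ) :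
    ‖projectedEuler C f h x₀ (k + n) - projectedEuler C f h x₀ k‖ ≤ 2 * M * (h * n) := by
  induction n with
  | zero => simp
  | succ n ih =>
    set y := projectedEuler C f h x₀
    have h1 : ‖y (k + n) + h • f (y (k + n)) - y (k + n + 1)‖ ≤ h * M :=
      norm_projectedEuler_defect_le hcl hco hx₀ hh hM (k + n)
    have h2 : ‖h • f (y (k + n))‖ ≤ h * M := by
      rw [norm_smul, Real.norm_of_nonneg hh]
      exact mul_le_mul_of_nonneg_left (hM _ (projectedEuler_mem hcl hco hx₀ h _)) hh
    have h3 : y (k + (n + 1)) - y k = (y (k + n) - y k) + h • f (y (k + n)) -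
        (y (k + n) + h • f (y (k + n)) - y (k + n + 1)) := by
      rw [← add_assoc]; abel
    rw [h3]
    refine (norm_sub_le _ _).trans ?_
    have := norm_add_le (y (k + n) - y k) (h • f (y (k + n)))
    push_cast
    linarith

/-- Discrete form of `ẋ ∈ f(x) - N_C(x)`, with field and normals both referred to the point `y k`.
Freezing the field there produces the constant `2KMR`, moving the base point of the normals produces
`2M²`. -/
theorem inner_projectedEuler_le (hcl : IsClosed C) (hco : Convex ℝ C) {x₀ : E}
    (hx₀ : x₀ ∈ C) {h M R : ℝ} {K : NNReal} (hh : 0 ≤ h) (hM : ∀ x ∈ C, ‖f x‖ ≤ M)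
    (hM0 : 0 ≤ M) (hR0 : 0 ≤ R)
    (hR : ∀ x ∈ C, ∀ z ∈ C, ‖x - z‖ ≤ R) (hf : LipschitzWith K f) {z : E} (hz : z ∈ C) (k n : ℕ) :
    inner ℝ (projectedEuler C f h x₀ (k + n) - projectedEuler C f h x₀ k -
        (h * n) • f (projectedEuler C f h x₀ k)) (projectedEuler C f h x₀ k - z) ≤
      (2 * K * M * R + 2 * M ^ 2) * (h * n) ^ 2 := by
  set B := 2 * K * M * R + 2 * M ^ 2 with hB
  induction n with
  | zero => simp
  | succ n ih =>
    have hmem := projectedEuler_mem (f := f) hcl hco hx₀ h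
    have hd := norm_projectedEuler_add_sub_le hcl hco hx₀ hh hM k
    have hdef := norm_projectedEuler_defect_le hcl hco hx₀ hh hM (k + n)
    have hnear := (isNearestPoint_projectedEuler_succ (f := f) hcl hco hx₀ h (k + n)).inner_le
      hco z hz
    rw [← add_assoc]
    set y := projectedEuler C f h x₀
    set e := y (k + n) + h • f (y (k + n)) - y (k + n + 1) with he
    have hsplit : y (k + n + 1) - y k - (h * (n + 1 : ℕ)) • f (y k) =
        (y (k + n) - y k - (h * n) • f (y k)) + h • (f (y (k + n)) - f (y k)) - e := by
      rw [he]
      push_cast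
      module
    have h1 : inner ℝ (h • (f (y (k + n)) - f (y k))) (y k - z) ≤
        h * (K * (2 * M * (h * n))) * R := by
      refine (real_inner_le_norm _ _).trans ?_
      refine mul_le_mul ?_ (hR _ (hmem k) _ hz) (norm_nonneg _) (by positivity)
      rw [norm_smul, Real.norm_of_nonneg hh]
      refine mul_le_mul_of_nonneg_left ?_ hh
      have := hf.dist_le_mul (y (k + n)) (y k)
      rw [dist_eq_norm, dist_eq_norm] at this
      exact this.trans (mul_le_mul_of_nonneg_left (hd n) K.coe_nonneg)
    have h2 : -inner ℝ e (y k - z) ≤ h * M * (2 * M * (h * (n + 1 : ℕ))) := by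
      -- The defect `e` is normal to `C` at the new iterate, not at `y k`; the second term pays for
      -- the change of base point.
      have e1 : -inner ℝ e (y k - z) =
          inner ℝ e (z - y (k + n + 1)) + inner ℝ e (y (k + (n + 1)) - y k) := by
        rw [← inner_add_right, ← inner_neg_right, ← add_assoc]
        congr 1
        abel
      have e2 : inner ℝ e (y (k + (n + 1)) - y k) ≤ h * M * (2 * M * (h * (n + 1 : ℕ))) :=
        (real_inner_le_norm _ _).trans
          (mul_le_mul hdef (hd (n + 1)) (norm_nonneg _) (by positivity))
      linarith
    rw [hsplit, inner_sub_left, inner_add_left]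
    have h3 : h * (K * (2 * M * (h * n))) * R + h * M * (2 * M * (h * (n + 1 : ℕ))) ≤
        B * (h ^ 2 * (n + 1)) := by
      have : 0 ≤ 2 * K * M * R * h ^ 2 := by positivity
      rw [hB]
      push_cast
      nlinarith
    -- The one-step error fits because `n² + (n + 1) ≤ (n + 1)²`.
    have h4 : B * (h * n) ^ 2 + B * (h ^ 2 * (n + 1)) ≤ B * (h * (n + 1 : ℕ)) ^ 2 := by
      have : 0 ≤ B * h ^ 2 * n := by positivity
      push_cast
      nlinarith
    linarith

theorem tendsto_inv_mul_floor {t : ℝ} (ht : 0 ≤ t) :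
    Tendsto (fun m : ℕ => ((m : ℝ) + 1)⁻¹ * (⌊t * (m + 1)⌋₊ : ℝ)) atTop (𝓝 t) := by
  have h := (tendsto_nat_floor_mul_div_atTop ht).comp
    ((tendsto_natCast_atTop_atTop (R := ℝ)).atTop_add (tendsto_const_nhds (x := (1 : ℝ))))
  refine h.congr fun m => ?_
  simp [div_eq_inv_mul]

/-- The Euler scheme converges to a Lipschitz curve in `C` that satisfies the variational inequality
of `ẋ ∈ f(x) - N_C(x)` up to an error of second order in time. -/
theorem exists_lipschitz_inner_le (hC : IsCompact C) (hco : Convex ℝ C) {K : NNReal}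
    (hf : LipschitzWith K f) {x₀ : E} (hx₀ : x₀ ∈ C) :
    ∃ (x : ℝ → E) (M : NNReal) (B : ℝ), x 0 = x₀ ∧ (∀ t, x t ∈ C) ∧
      LipschitzOnWith M x (Ici 0) ∧ ∀ s t, 0 ≤ s → s ≤ t → ∀ z ∈ C,
        inner ℝ (x t - x s - (t - s) • f (x s)) (x s - z) ≤ B * (t - s) ^ 2 := by
  have hcl := hC.isClosed
  obtain ⟨M, hM⟩ := hC.exists_bound_of_continuousOn hf.continuous.continuousOn
  have hM0 : 0 ≤ M := (norm_nonneg _).trans (hM x₀ hx₀)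
  have hR : ∀ x ∈ C, ∀ z ∈ C, ‖x - z‖ ≤ Metric.diam C := fun x hx z hz => by
    rw [← dist_eq_norm]; exact Metric.dist_le_diam_of_mem hC.isBounded hx hz
  -- Step size `1/(m+1)`. For negative `t` the floor is `0`, so the curve waits at `x₀` and lies in
  -- `C` at all real times.
  set X : ℕ → ℝ → E := fun m t =>
    projectedEuler C f ((m : ℝ) + 1)⁻¹ x₀ ⌊t * (m + 1)⌋₊ with hX
  set U := Filter.hyperfilter ℕ
  have hU : (U : Filter ℕ) ≤ atTop := Nat.hyperfilter_le_atTop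
  have hlim : ∀ t, ∃ y ∈ C, Tendsto (fun m => X m t) U (𝓝 y) := fun t => by
    have : ∀ᶠ m in (U : Filter ℕ), X m t ∈ C :=
      Eventually.of_forall fun m => projectedEuler_mem hcl hco hx₀ _ _
    exact hC.ultrafilter_le_nhds (U.map fun m => X m t) (le_principal_iff.2 this)
  choose x hxC hxlim using hlim
  have hstep : ∀ m : ℕ, 0 ≤ ((m : ℝ) + 1)⁻¹ := fun m => by positivity
  have hfloor : ∀ {s t : ℝ}, s ≤ t → ∀ m : ℕ, ∃ n : ℕ, ⌊t * (m + 1)⌋₊ = ⌊s * (m + 1)⌋₊ + n :=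
    fun hst m => Nat.exists_eq_add_of_le (Nat.floor_le_floor (by gcongr))
  have htime : ∀ {s t : ℝ}, 0 ≤ s → 0 ≤ t → Tendsto (fun m : ℕ =>
      ((m : ℝ) + 1)⁻¹ * (⌊t * (m + 1)⌋₊ : ℝ) - ((m : ℝ) + 1)⁻¹ * (⌊s * (m + 1)⌋₊ : ℝ)) U
      (𝓝 (t - s)) :=
    fun hs ht => ((tendsto_inv_mul_floor ht).sub (tendsto_inv_mul_floor hs)).mono_left hU
  have hlip : ∀ s t, 0 ≤ s → s ≤ t → ‖x t - x s‖ ≤ 2 * M * (t - s) := by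
    intro s t hs hst
    refine le_of_tendsto_of_tendsto ((hxlim t).sub (hxlim s)).norm
      ((htime hs (hs.trans hst)).const_mul (2 * M)) (Eventually.of_forall fun m => ?_)
    obtain ⟨n, hn⟩ := hfloor hst m
    have := norm_projectedEuler_add_sub_le hcl hco hx₀ (hstep m) hM ⌊s * (m + 1)⌋₊ n
    simp only [hX, hn]
    rwa [Nat.cast_add, ← mul_sub, add_sub_cancel_left]
  refine ⟨x, (2 * M).toNNReal, 2 * K * M * Metric.diam C + 2 * M ^ 2, ?_, hxC, ?_, ?_⟩
  · refine tendsto_nhds_unique (hxlim 0) ?_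
    simp [hX, projectedEuler]
  · refine LipschitzOnWith.of_dist_le_mul fun s hs t ht => ?_
    rw [Real.coe_toNNReal _ (by positivity)]
    rcases le_total s t with h | h
    · rw [dist_comm, dist_comm s, dist_eq_norm, Real.dist_eq, abs_of_nonneg (sub_nonneg.2 h)]
      exact hlip s t hs h
    · rw [dist_eq_norm, Real.dist_eq, abs_of_nonneg (sub_nonneg.2 h)]
      exact hlip t s ht h
  · intro s t hs hst z hz
    have hT := htime hs (hs.trans hst)
    refine le_of_tendsto_of_tendsto
      ((((hxlim t).sub (hxlim s)).sub (hT.smul ((hf.continuous.tendsto _).comp (hxlim s)))).inner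
        ((hxlim s).sub tendsto_const_nhds))
      ((hT.pow 2).const_mul (2 * K * M * Metric.diam C + 2 * M ^ 2))
      (Eventually.of_forall fun m => ?_)
    obtain ⟨n, hn⟩ := hfloor hst m
    have := inner_projectedEuler_le hcl hco hx₀ (hstep m) hM hM0 Metric.diam_nonneg hR hf hz
      ⌊s * (m + 1)⌋₊ n
    simp only [hX, hn, Function.comp]
    rwa [Nat.cast_add, ← mul_sub, add_sub_cancel_left]

omit [CompleteSpace E] in
-- Dividing by `s - t` and letting `s ↓ t` removes the second-order error.
theorem inner_hasDerivAt_sub_le {x : ℝ → E} {B t : ℝ} {v z : E} (hx : HasDerivAt x v t)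
    (h : ∀ s, t ≤ s → inner ℝ (x s - x t - (s - t) • f (x t)) (x t - z) ≤ B * (s - t) ^ 2) :
    inner ℝ (v - f (x t)) (x t - z) ≤ 0 := by
  have h1 : Tendsto (fun s => inner ℝ (slope x t s - f (x t)) (x t - z)) (𝓝[>] t)
      (𝓝 (inner ℝ (v - f (x t)) (x t - z))) :=
    (((hasDerivAt_iff_tendsto_slope.1 hx).mono_left (nhdsGT_le_nhdsNE t)).sub
      tendsto_const_nhds).inner tendsto_const_nhds
  have h2 : Tendsto (fun s => B * (s - t)) (𝓝[>] t) (𝓝 0) := by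
    have : Tendsto (fun s => B * (s - t)) (𝓝 t) (𝓝 (B * (t - t))) :=
      Continuous.tendsto (by fun_prop) t
    simpa using this.mono_left nhdsWithin_le_nhds
  refine le_of_tendsto_of_tendsto h1 h2 ?_
  filter_upwards [self_mem_nhdsWithin] with s hs
  have hpos : 0 < s - t := sub_pos.2 hs
  have e : x s - x t - (s - t) • f (x t) = (s - t) • (slope x t s - f (x t)) := by
    rw [slope_def_module, smul_sub, smul_smul, mul_inv_cancel₀ hpos.ne', one_smul]
  have := h s (le_of_lt hs)
  rw [e, real_inner_smul_left] at this
  nlinarith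

end Euler

theorem exists_isProjectedSolution_euclideanBox {ι : Type*} [Fintype ι] {l u : ι → ℝ}
    {f : EuclideanSpace ℝ ι → EuclideanSpace ℝ ι} {K : NNReal} (hf : LipschitzWith K f)
    {x₀ : EuclideanSpace ℝ ι} (hx₀ : x₀ ∈ euclideanBox l u) :
    ∃ x, IsProjectedSolution (euclideanBox l u) f x ∧ x 0 = x₀ := by
  obtain ⟨x, M, B, h0, hxC, hlip, hin⟩ :=
    exists_lipschitz_inner_le (isCompact_euclideanBox l u) (convex_euclideanBox l u) hf hx₀
  refine ⟨x, ⟨fun t _ => hxC t, fun T hT => ?_, ?_⟩, h0⟩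
  · refine LipschitzOnWith.absolutelyContinuousOnInterval (K := M) (hlip.mono ?_)
    rw [uIcc_of_le hT]
    exact Icc_subset_Ici_self
  have hdiff : ∀ᵐ t ∂(volume.restrict (Ici (0 : ℝ))), DifferentiableWithinAt ℝ x (Ici 0) t :=
    hlip.ae_differentiableWithinAt measurableSet_Ici
  -- Time `0` is discarded, since `Ici 0` is not a neighbourhood of it.
  rw [restrict_Ioi_eq_restrict_Ici.symm] at hdiff ⊢
  filter_upwards [hdiff, ae_restrict_mem measurableSet_Ioi] with t ht hpos
  have hnhds : Ici (0 : ℝ) ∈ 𝓝 t := Ici_mem_nhds hpos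
  have hd := (ht.differentiableAt hnhds).hasDerivAt
  convert hd using 1
  ext i
  have hdi : HasDerivAt (fun s => x s i) (deriv x t i) t :=
    (EuclideanSpace.proj (𝕜 := ℝ) i).hasFDerivAt.comp_hasDerivAt t hd
  rw [projectedField_euclideanBox_apply (hxC t)]
  symm
  refine eq_intervalProj (hxC t i) (fun e => ?_) (fun e => ?_) fun z hz => ?_
  -- A coordinate at an endpoint of its interval is at a two-sided extremum in time, so its
  -- derivative vanishes.
  · refine IsLocalMin.hasDerivAt_eq_zero (Eventually.of_forall fun s => ?_) hdi
    simpa [e] using (hxC s i).1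
  · refine IsLocalMax.hasDerivAt_eq_zero (Eventually.of_forall fun s => ?_) hdi
    simpa [e] using (hxC s i).2
  · classical
    -- Changing only coordinate `i` isolates the scalar variational inequality.
    set Z : EuclideanSpace ℝ ι := WithLp.toLp 2 (Function.update (x t) i z) with hZ
    have hZC : Z ∈ euclideanBox l u := fun j => by
      by_cases hj : j = i
      · subst hj; simpa [hZ] using hz
      · simpa [hZ, hj] using hxC t j
    have := inner_hasDerivAt_sub_le hd fun s hs => hin t s (le_of_lt hpos) hs Z hZC
    rw [PiLp.inner_apply, Finset.sum_eq_single i] at this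
    · simpa [hZ, mul_comm] using this
    · intro j _ hj
      simp [hZ, hj]
    · simp

/-! ### Asymptotic stability -/

section Stability

variable {ι : Type*} [Fintype ι] {l u : ι → ℝ} {f : EuclideanSpace ℝ ι → EuclideanSpace ℝ ι}

/-- For a dissipative vector field it suffices that every solution accumulates at a stationary
point. -/
theorem isGloballyAsymptoticallyStable_of_mem_closure {K : NNReal} (hf : LipschitzWith K f)
    (hmono : ∀ a ∈ euclideanBox l u, ∀ b ∈ euclideanBox l u, inner ℝ (a - b) (f a - f b) ≤ 0)
    (hne : (stationarySet (euclideanBox l u) f).Nonempty)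
    (hacc : ∀ x, IsProjectedSolution (euclideanBox l u) f x →
      ∃ h ∈ stationarySet (euclideanBox l u) f, h ∈ closure (x '' Ici 0)) :
    IsGloballyAsymptoticallyStable (euclideanBox l u) f
      (stationarySet (euclideanBox l u) f) := by
  have hcpt := isCompact_stationarySet_euclideanBox l u hf.continuous
  refine ⟨hne, hcpt, fun x₀ hx₀ => exists_isProjectedSolution_euclideanBox hf hx₀, ?_, ?_⟩
  -- The distance to the stationary point nearest to `x 0` does not increase.
  · refine fun ε hε => ⟨ε, hε, fun x hx h0 t ht => ?_⟩
    obtain ⟨h, hh, hd⟩ := hcpt.exists_infDist_eq_dist hne (x 0)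
    have := hx.antitoneOn_dist_stationary hmono hh (mem_Ici.2 le_rfl) (mem_Ici.2 ht) ht
    exact ((Metric.infDist_le_dist_of_mem hh).trans this).trans_lt (hd.symm.trans_lt h0)
  · intro x hx
    obtain ⟨h, hh, hcl⟩ := hacc x hx
    have hanti := hx.antitoneOn_dist_stationary hmono hh
    rw [Metric.tendsto_atTop]
    intro ε hε
    obtain ⟨_, ⟨s, hs, rfl⟩, hlt⟩ := Metric.mem_closure_iff.1 hcl ε hε
    refine ⟨s, fun t ht => ?_⟩
    rw [Real.dist_0_eq_abs, abs_of_nonneg Metric.infDist_nonneg]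
    refine (Metric.infDist_le_dist_of_mem hh).trans_lt ?_
    refine (hanti hs (mem_Ici.2 (le_trans hs ht)) ht).trans_lt ?_
    rwa [dist_comm] at hlt

end Stability

/-! ### Monotone coordinates and frozen quantities -/

theorem AntitoneOn.exists_tendsto_atTop {g : ℝ → ℝ} (hg : AntitoneOn g (Ici 0)) {m : ℝ}
    (hm : ∀ t, 0 ≤ t → m ≤ g t) : ∃ c, Tendsto g atTop (𝓝 c) := by
  have hanti : Antitone fun t => g (max t 0) := fun s t hst =>
    hg (le_max_right s 0) (le_max_right t 0) (max_le_max_right 0 hst)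
  refine ⟨_, (tendsto_atTop_ciInf hanti ⟨m, ?_⟩).congr' ?_⟩
  · rintro _ ⟨t, rfl⟩
    exact hm _ (le_max_right t 0)
  · filter_upwards [eventually_ge_atTop 0] with t ht
    rw [max_eq_left ht]

theorem MonotoneOn.exists_tendsto_atTop {g : ℝ → ℝ} (hg : MonotoneOn g (Ici 0)) {m : ℝ}
    (hm : ∀ t, 0 ≤ t → g t ≤ m) : ∃ c, Tendsto g atTop (𝓝 c) := by
  obtain ⟨c, hc⟩ := AntitoneOn.exists_tendsto_atTop hg.neg (m := -m)
    fun t ht => neg_le_neg (hm t ht)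
  exact ⟨-c, by simpa using hc.neg⟩

namespace IsProjectedSolution

variable {ι : Type*} [Fintype ι] {l u : ι → ℝ} {f : EuclideanSpace ℝ ι → EuclideanSpace ℝ ι}
  {x : ℝ → EuclideanSpace ℝ ι}

/-- Projection keeps the sign of the velocity, so the coordinate is monotone, and the box bounds it.
-/
theorem exists_tendsto_apply_of_nonpos (hx : IsProjectedSolution (euclideanBox l u) f x) (i : ι)
    (h : ∀ᵐ t ∂(volume.restrict (Ici (0 : ℝ))), f (x t) i ≤ 0) :
    ∃ c, Tendsto (fun t => x t i) atTop (𝓝 c) := by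
  refine AntitoneOn.exists_tendsto_atTop (antitoneOn_of_ae_deriv_nonpos
    (fun T hT => hx.absolutelyContinuousOnInterval_apply i hT) ?_) (fun t ht => (hx.1 t ht i).1)
  filter_upwards [h, hx.ae_hasDerivAt_apply] with t ht hd
  rw [(hd i).deriv]
  exact intervalProj_nonpos _ _ _ ht

theorem exists_tendsto_apply_of_nonneg (hx : IsProjectedSolution (euclideanBox l u) f x) (i : ι)
    (h : ∀ᵐ t ∂(volume.restrict (Ici (0 : ℝ))), 0 ≤ f (x t) i) :
    ∃ c, Tendsto (fun t => x t i) atTop (𝓝 c) := by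
  refine MonotoneOn.exists_tendsto_atTop (monotoneOn_of_ae_deriv_nonneg
    (fun T hT => hx.absolutelyContinuousOnInterval_apply i hT) ?_) (fun t ht => (hx.1 t ht i).2)
  filter_upwards [h, hx.ae_hasDerivAt_apply] with t ht hd
  rw [(hd i).deriv]
  exact intervalProj_nonneg _ _ _ ht

/-- A coordinate that stays constant has zero projected velocity. -/
theorem ae_intervalProj_eq_zero (hx : IsProjectedSolution (euclideanBox l u) f x) {i : ι} {c : ℝ}
    (h : ∀ t, 0 ≤ t → x t i = c) :
    ∀ᵐ t ∂(volume.restrict (Ici (0 : ℝ))), intervalProj (l i) (u i) c (f (x t) i) = 0 := by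
  have hd := hx.ae_hasDerivAt_apply
  rw [← restrict_Ioi_eq_restrict_Ici] at hd ⊢
  filter_upwards [hd, ae_restrict_mem measurableSet_Ioi] with t ht h0
  rw [← h t (le_of_lt h0)]
  refine (ht i).unique ((hasDerivAt_const t c).congr_of_eventuallyEq ?_)
  filter_upwards [Ioi_mem_nhds h0] with s hs
  exact h s (le_of_lt hs)

/-- If the distance to a zero of the field is constant along a solution, then the solution does
not dissipate. -/
theorem ae_inner_nonneg_of_dist_const (hx : IsProjectedSolution (euclideanBox l u) f x)
    {a : EuclideanSpace ℝ ι} (ha : a ∈ euclideanBox l u) (hfa : f a = 0) {c : ℝ}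
    (h : ∀ t, 0 ≤ t → dist (x t) a = c) :
    ∀ᵐ t ∂(volume.restrict (Ici (0 : ℝ))), 0 ≤ inner ℝ (x t - a) (f (x t) - f a) := by
  have hd := hx.2.2
  rw [← restrict_Ioi_eq_restrict_Ici] at hd ⊢
  filter_upwards [hd, ae_restrict_mem measurableSet_Ioi] with t ht h0
  have h1 := (ht.sub_const a).norm_sq
  have h2 : HasDerivAt (fun s => ‖x s - a‖ ^ 2) 0 t := by
    refine (hasDerivAt_const t (c ^ 2)).congr_of_eventuallyEq ?_
    filter_upwards [Ioi_mem_nhds h0] with s hs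
    rw [← h s (le_of_lt hs), dist_eq_norm]
  have h3 := h1.unique h2
  have h4 := inner_projectedField_le (hx.1 t (le_of_lt h0)) ha f
  rw [hfa, sub_zero]
  linarith

end IsProjectedSolution

/-! ### The saddle point dynamics -/

section Saddle

variable {J : Type*} [Fintype J]

/-- The block `k` of a stacked vector. -/
def stackedBlock {n : ℕ} (x : EuclideanSpace ℝ (Fin n × J)) (k : Fin n) : J → ℝ := fun a => x (k, a)

/-- The vector field
`(θ, v, μ, w) ↦ (-Gθ - Bw + c, -v + Lw, Lw, Bᵀθ - Lv - Lμ)`. -/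
noncomputable def saddleField (G B L : Matrix J J ℝ) (c : J → ℝ)
    (x : EuclideanSpace ℝ (Fin 4 × J)) : EuclideanSpace ℝ (Fin 4 × J) :=
  WithLp.toLp 2 fun p =>
    (![-(G *ᵥ stackedBlock x 0) - B *ᵥ stackedBlock x 3 + c,
      -stackedBlock x 1 + L *ᵥ stackedBlock x 3,
      L *ᵥ stackedBlock x 3,
      Bᵀ *ᵥ stackedBlock x 0 - L *ᵥ stackedBlock x 1 - L *ᵥ stackedBlock x 2] :
        Fin 4 → J → ℝ) p.1 p.2

theorem inner_eq_sum_dotProduct (x y : EuclideanSpace ℝ (Fin 4 × J)) :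
    inner ℝ x y = stackedBlock x 0 ⬝ᵥ stackedBlock y 0 + stackedBlock x 1 ⬝ᵥ stackedBlock y 1 +
      stackedBlock x 2 ⬝ᵥ stackedBlock y 2 + stackedBlock x 3 ⬝ᵥ stackedBlock y 3 := by
  rw [PiLp.inner_apply, Fintype.sum_prod_type, Fin.sum_univ_four]
  simp [dotProduct, stackedBlock, mul_comm]

variable {G B L : Matrix J J ℝ} {c : J → ℝ}

/-- The terms in `B` and `Bᵀ` cancel, and so do those in `L` because `L` is symmetric. -/
theorem inner_saddleField_sub (hL : Lᵀ = L) (x y : EuclideanSpace ℝ (Fin 4 × J)) :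
    inner ℝ (x - y) (saddleField G B L c x - saddleField G B L c y) =
      -(stackedBlock (x - y) 0 ⬝ᵥ G *ᵥ stackedBlock (x - y) 0) -
        stackedBlock (x - y) 1 ⬝ᵥ stackedBlock (x - y) 1 := by
  have hsub : ∀ k, stackedBlock (x - y) k = stackedBlock x k - stackedBlock y k := fun k => rfl
  have h0 : stackedBlock (saddleField G B L c x - saddleField G B L c y) 0 =
      -(G *ᵥ stackedBlock (x - y) 0) - B *ᵥ stackedBlock (x - y) 3 := by
    ext a
    simp [stackedBlock, saddleField, hsub, mulVec_sub]
    ring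
  have h1 : stackedBlock (saddleField G B L c x - saddleField G B L c y) 1 =
      -stackedBlock (x - y) 1 + L *ᵥ stackedBlock (x - y) 3 := by
    ext a
    simp [stackedBlock, saddleField, hsub, mulVec_sub]
    ring
  have h2 : stackedBlock (saddleField G B L c x - saddleField G B L c y) 2 =
      L *ᵥ stackedBlock (x - y) 3 := by
    ext a
    simp [stackedBlock, saddleField, hsub, mulVec_sub]
  have h3 : stackedBlock (saddleField G B L c x - saddleField G B L c y) 3 =
      Bᵀ *ᵥ stackedBlock (x - y) 0 - L *ᵥ stackedBlock (x - y) 1 -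
        L *ᵥ stackedBlock (x - y) 2 := by
    ext a
    simp [stackedBlock, saddleField, hsub, mulVec_sub]
    ring
  have hsymm : ∀ (M : Matrix J J ℝ) (v w : J → ℝ), v ⬝ᵥ Mᵀ *ᵥ w = w ⬝ᵥ M *ᵥ v := fun M v w => by
    rw [mulVec_transpose, dotProduct_comm, ← dotProduct_mulVec]
  have hB := hsymm B (stackedBlock (x - y) 3) (stackedBlock (x - y) 0)
  have hL1 := hsymm L (stackedBlock (x - y) 3) (stackedBlock (x - y) 1)
  have hL2 := hsymm L (stackedBlock (x - y) 3) (stackedBlock (x - y) 2)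
  rw [hL] at hL1 hL2
  rw [inner_eq_sum_dotProduct, h0, h1, h2, h3]
  simp only [dotProduct_sub, dotProduct_add, dotProduct_neg]
  linarith

theorem inner_saddleField_sub_nonpos (hL : Lᵀ = L) (hG : G.PosDef)
    (x y : EuclideanSpace ℝ (Fin 4 × J)) :
    inner ℝ (x - y) (saddleField G B L c x - saddleField G B L c y) ≤ 0 := by
  rw [inner_saddleField_sub hL]
  have h1 := hG.posSemidef.dotProduct_mulVec_nonneg (stackedBlock (x - y) 0)
  have h2 : 0 ≤ stackedBlock (x - y) 1 ⬝ᵥ stackedBlock (x - y) 1 :=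
    Finset.sum_nonneg fun _ _ => mul_self_nonneg _
  rw [star_trivial] at h1
  linarith

/-- Every solution of the saddle point dynamics in a box accumulates at a stationary point. -/
theorem exists_stationary_mem_closure_saddleField {l u : Fin 4 × J → ℝ} (hL : Lᵀ = L)
    (hG : G.PosDef) {K : NNReal} (hf : LipschitzWith K (saddleField G B L c))
    (hlu : ∀ a, l (1, a) < u (1, a)) {e : EuclideanSpace ℝ (Fin 4 × J)}
    (he : e ∈ euclideanBox l u) (hfe : saddleField G B L c e = 0) (hev : ∀ a, e (1, a) = 0)
    {x : ℝ → EuclideanSpace ℝ (Fin 4 × J)}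
    (hx : IsProjectedSolution (euclideanBox l u) (saddleField G B L c) x) :
    ∃ h ∈ stationarySet (euclideanBox l u) (saddleField G B L c), h ∈ closure (x '' Ici 0) := by
  set f := saddleField G B L c with hfdef
  have hmono : ∀ a ∈ euclideanBox l u, ∀ b ∈ euclideanBox l u, inner ℝ (a - b) (f a - f b) ≤ 0 :=
    fun a _ b _ => inner_saddleField_sub_nonpos hL hG a b
  have hex := fun x₀ (h : x₀ ∈ euclideanBox l u) =>
    exists_isProjectedSolution_euclideanBox (f := f) hf h
  have hcoord : ∀ i, Continuous fun x : EuclideanSpace ℝ (Fin 4 × J) => x i := by fun_prop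
  obtain ⟨y, hy, hycl, hylim⟩ := hx.exists_limit_solution hmono hex
  obtain ⟨r, hr⟩ := AntitoneOn.exists_tendsto_atTop
    (hx.antitoneOn_dist_stationary hmono (mem_stationarySet_of_eq_zero he hfe))
    (fun _ _ => dist_nonneg)
  have hydist : ∀ t, 0 ≤ t → dist (y t) e = r :=
    hylim (fun z => dist z e) r (by fun_prop) hr
  -- With the distance to `e` frozen, both nonnegative dissipation terms must vanish.
  have hdiss : ∀ᵐ t ∂(volume.restrict (Ici (0 : ℝ))),
      stackedBlock (y t - e) 0 = 0 ∧ stackedBlock (y t - e) 1 = 0 := by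
    filter_upwards [hy.ae_inner_nonneg_of_dist_const he hfe hydist] with t ht
    rw [inner_saddleField_sub hL] at ht
    have h1 : 0 ≤ stackedBlock (y t - e) 1 ⬝ᵥ stackedBlock (y t - e) 1 :=
      Finset.sum_nonneg fun _ _ => mul_self_nonneg _
    by_cases h0 : stackedBlock (y t - e) 0 = 0
    · refine ⟨h0, dotProduct_self_eq_zero.1 ?_⟩
      simp only [h0, zero_dotProduct] at ht
      linarith
    · have := hG.dotProduct_mulVec_pos h0
      simp only [star_trivial] at this
      linarith
  have hyfix : ∀ k : Fin 4, k = 0 ∨ k = 1 → ∀ a t, 0 ≤ t → y t (k, a) = e (k, a) := by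
    intro k hk a
    refine eqOn_Ici_of_ae_eq ?_ ((hcoord (k, a)).comp_continuousOn hy.continuousOn)
      continuousOn_const
    filter_upwards [hdiss] with t ht
    have : stackedBlock (y t - e) k = 0 := by
      rcases hk with rfl | rfl
      exacts [ht.1, ht.2]
    exact sub_eq_zero.1 (congrFun this a)
  have hymu : ∀ a, ∃ m, Tendsto (fun t => y t (2, a)) atTop (𝓝 m) := by
    intro a
    have hv : ∀ᵐ t ∂(volume.restrict (Ici (0 : ℝ))),
        intervalProj (l (1, a)) (u (1, a)) 0 (f (y t) (2, a)) = 0 := by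
      filter_upwards [hy.ae_intervalProj_eq_zero (hyfix 1 (Or.inr rfl) a),
        ae_restrict_mem measurableSet_Ici] with t ht h0
      -- At `v = 0` the fields of `v_a` and `μ_a` are the same number `(Lw)_a`.
      have e1 : f (y t) (1, a) = f (y t) (2, a) := by
        have : y t (1, a) = 0 := by rw [hyfix 1 (Or.inr rfl) a t h0, hev]
        simp [hfdef, saddleField, stackedBlock, this]
      rw [hev, e1] at ht
      exact ht
    -- By nondegeneracy `0` is not both ends of the interval. A free upper end excludes `(Lw)_a >
    -- 0`, a free lower end excludes `(Lw)_a < 0`.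
    rcases lt_or_ge 0 (u (1, a)) with hu | hu
    · refine hy.exists_tendsto_apply_of_nonpos _ ?_
      filter_upwards [hv] with t ht
      exact nonpos_of_intervalProj_eq_zero hu ht
    · refine hy.exists_tendsto_apply_of_nonneg _ ?_
      filter_upwards [hv] with t ht
      exact nonneg_of_intervalProj_eq_zero ((hlu a).trans_le hu) ht
  choose m hm using hymu
  obtain ⟨z, hz, hzcl, hzlim⟩ := hy.exists_limit_solution hmono hex
  have hyconv : ∀ k : Fin 4, k = 0 ∨ k = 1 → ∀ a,
      Tendsto (fun t => y t (k, a)) atTop (𝓝 (e (k, a))) := fun k hk a =>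
    tendsto_const_nhds.congr' ((eventually_ge_atTop 0).mono fun t ht => (hyfix k hk a t ht).symm)
  have hz0 : ∀ a t, 0 ≤ t → z t (0, a) = e (0, a) := fun a =>
    hzlim _ _ (hcoord (0, a)) (hyconv 0 (Or.inl rfl) a)
  have hz1 : ∀ a t, 0 ≤ t → z t (1, a) = e (1, a) := fun a =>
    hzlim _ _ (hcoord (1, a)) (hyconv 1 (Or.inr rfl) a)
  have hz2 : ∀ a t, 0 ≤ t → z t (2, a) = m a := fun a => hzlim _ _ (hcoord (2, a)) (hm a)
  have hz3 : ∀ a, ∃ w, Tendsto (fun t => z t (3, a)) atTop (𝓝 w) := by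
    intro a
    -- The `w`-component of the field does not involve `w`, and the other blocks are frozen along
    -- `z`.
    have hconst : ∀ t, 0 ≤ t → f (z t) (3, a) = f (z 0) (3, a) := by
      intro t ht
      have e0 : stackedBlock (z t) 0 = stackedBlock (z 0) 0 :=
        funext fun a => (hz0 a t ht).trans (hz0 a 0 le_rfl).symm
      have e1 : stackedBlock (z t) 1 = stackedBlock (z 0) 1 :=
        funext fun a => (hz1 a t ht).trans (hz1 a 0 le_rfl).symm
      have e2 : stackedBlock (z t) 2 = stackedBlock (z 0) 2 :=
        funext fun a => (hz2 a t ht).trans (hz2 a 0 le_rfl).symm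
      simp [hfdef, saddleField, e0, e1, e2]
    rcases le_total (f (z 0) (3, a)) 0 with h | h
    · refine hz.exists_tendsto_apply_of_nonpos _ ?_
      filter_upwards [ae_restrict_mem measurableSet_Ici] with t ht
      rwa [hconst t ht]
    · refine hz.exists_tendsto_apply_of_nonneg _ ?_
      filter_upwards [ae_restrict_mem measurableSet_Ici] with t ht
      rwa [hconst t ht]
  have hzconv : ∀ i, ∃ w, Tendsto (fun t => z t i) atTop (𝓝 w) := by
    have key : ∀ i w, (∀ t, 0 ≤ t → z t i = w) → ∃ w, Tendsto (fun t => z t i) atTop (𝓝 w) :=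
      fun i w h => ⟨w, tendsto_const_nhds.congr'
        ((eventually_ge_atTop 0).mono fun t ht => (h t ht).symm)⟩
    rintro ⟨k, a⟩
    fin_cases k
    exacts [key _ _ (hz0 a), key _ _ (hz1 a), key _ _ (hz2 a), hz3 a]
  choose w hw using hzconv
  obtain ⟨p, hp, hpcl, hplim⟩ := hz.exists_limit_solution hmono hex
  have hpconst : ∀ t, 0 ≤ t → p t = WithLp.toLp 2 w := fun t ht => by
    ext i
    exact hplim _ _ (hcoord i) (hw i) t ht
  -- Accumulation is transitive: the orbit closures of `p`, `z`, `y`, `x` are nested.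
  have hsub : ∀ {g g' : ℝ → EuclideanSpace ℝ (Fin 4 × J)},
      (∀ t, 0 ≤ t → g' t ∈ closure (g '' Ici 0)) → closure (g' '' Ici 0) ⊆ closure (g '' Ici 0) :=
    fun h => closure_minimal (by rintro _ ⟨t, ht, rfl⟩; exact h t ht) isClosed_closure
  refine ⟨WithLp.toLp 2 w, hp.mem_stationarySet_of_const hpconst, hsub hycl (hsub hzcl ?_)⟩
  rw [← hpconst 0 le_rfl]
  exact hpcl 0 le_rfl

end Saddle

/-! ### The distributed gradient temporal-difference dynamics as saddle point dynamics -/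

namespace DGTD

variable {N q : ℕ} {X : Type*} [Fintype X] [DecidableEq X]

theorem constraintSet_Icc_eq (lθ uθ lv uv lμ uμ lw uw : Idx N q → ℝ) :
    constraintSet (Icc lθ uθ) (Icc lv uv) (Icc lμ uμ) (Icc lw uw) =
      euclideanBox (fun p : Fin 4 × Idx N q => (![lθ, lv, lμ, lw] : Fin 4 → _) p.1 p.2)
        (fun p => (![uθ, uv, uμ, uw] : Fin 4 → _) p.1 p.2) := by
  ext x
  simp only [constraintSet, euclideanBox, mem_ofPred_eq, Prod.forall, Fin.forall_fin_succ, mem_Icc,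
    Pi.le_def, forall_and]
  simp
  tauto

theorem transpose_barL (G : SimpleGraph (Fin N)) [DecidableRel G.Adj] :
    (barL q G)ᵀ = barL q G := by
  rw [barL, ← kroneckerMap_transpose, transpose_one, (G.isSymm_lapMatrix (R := ℝ)).eq]

omit [Fintype X] in
theorem transpose_barD (d : X → ℝ) : (barD N d)ᵀ = barD N d := by
  rw [barD, ← kroneckerMap_transpose, transpose_one, diagonal_transpose]

/-- Matches the expanded form of `B̄ᵀ` in `matA` and `setF`. -/
theorem transpose_barB (γ : ℝ) (P : Matrix X X ℝ) (d : X → ℝ) (Φ : Matrix X (Fin q) ℝ) :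
    (barB N γ P d Φ)ᵀ = (barΦ N Φ)ᵀ * (1 - γ • barP N P)ᵀ * barD N d * barΦ N Φ := by
  simp only [barB, transpose_mul, transpose_transpose, transpose_barD, Matrix.mul_assoc]

theorem barL_mulVec_stack (G : SimpleGraph (Fin N)) [DecidableRel G.Adj] (w : Fin q → ℝ) :
    barL q G *ᵥ stack N w = 0 := by
  ext ⟨i, j⟩
  have h := congrFun (G.lapMatrix_mulVec_const_eq_zero (R := ℝ)) i
  simp only [mulVec, dotProduct, mul_one, Pi.zero_apply] at h
  simp only [mulVec, dotProduct, barL, stack, kroneckerMap_apply, Fintype.sum_prod_type,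
    Pi.zero_apply]
  simp [Matrix.one_apply, ← Finset.sum_mul, h]

/-- `Φ̄ᵀ D̄ Φ̄` is positive definite. -/
theorem posDef_gram {d : X → ℝ} (hd : ∀ s, 0 < d s) {Φ : Matrix X (Fin q) ℝ} (hΦ : Φ.rank = q) :
    ((barΦ N Φ)ᵀ * barD N d * barΦ N Φ).PosDef := by
  have hinj : Function.Injective Φ.mulVec := by
    rw [mulVec_injective_iff, linearIndependent_iff_card_eq_finrank_span, Fintype.card_fin,
      Set.finrank, ← rank_eq_finrank_span_cols, hΦ]
  have h : (Φᵀ * diagonal d * Φ).PosDef := by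
    rw [← conjTranspose_eq_transpose_of_trivial]
    exact (PosDef.diagonal hd).conjTranspose_mul_mul_same hinj
  have e : (barΦ N Φ)ᵀ * barD N d * barΦ N Φ =
      (1 : Matrix (Fin N) (Fin N) ℝ) ⊗ₖ (Φᵀ * diagonal d * Φ) := by
    rw [barΦ, barD, ← kroneckerMap_transpose, transpose_one, ← mul_kronecker_mul,
      ← mul_kronecker_mul, one_mul, one_mul]
  rw [e]
  exact PosDef.one.kronecker h

theorem field_eq_saddleField (G : SimpleGraph (Fin N)) [DecidableRel G.Adj] (γ : ℝ)
    (P : Matrix X X ℝ) (d : X → ℝ) (Φ : Matrix X (Fin q) ℝ) (r : Fin N → X → ℝ) :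
    field G γ P d Φ r = saddleField ((barΦ N Φ)ᵀ * barD N d * barΦ N Φ) (barB N γ P d Φ)
      (barL q G) (((barΦ N Φ)ᵀ * barD N d) *ᵥ barR r) := by
  funext x
  ext ⟨k, a⟩
  rw [saddleField, transpose_barB]
  have hrow : (matA G γ P d Φ *ᵥ WithLp.ofLp x) (k, a) =
      ∑ k', ∑ b, matA G γ P d Φ (k, a) (k', b) * x (k', b) := by
    simp only [mulVec, dotProduct, Fintype.sum_prod_type]
  have hx : field G γ P d Φ r x (k, a) =
    -(matA G γ P d Φ *ᵥ WithLp.ofLp x) (k, a) - vecB d Φ r (k, a) := rfl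
  rw [hx, hrow, Fin.sum_univ_four]
  set x0 := stackedBlock x 0
  set x1 := stackedBlock x 1
  set x2 := stackedBlock x 2
  set x3 := stackedBlock x 3
  set Q := (barΦ N Φ)ᵀ * barD N d * barΦ N Φ
  set c := ((barΦ N Φ)ᵀ * barD N d) *ᵥ barR r
  set B := barB N γ P d Φ
  set B' := (barΦ N Φ)ᵀ * (1 - γ • barP N P)ᵀ * barD N d * barΦ N Φ
  set Z : Matrix (Idx N q) (Idx N q) ℝ := 0 with hZ
  fin_cases k
  · change -((Q *ᵥ x0) a + (Z *ᵥ x1) a + (Z *ᵥ x2) a + (B *ᵥ x3) a) - (-c) a =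
      (-(Q *ᵥ x0) - B *ᵥ x3 + c) a
    simp only [hZ, zero_mulVec, Pi.add_apply, Pi.sub_apply, Pi.neg_apply, Pi.zero_apply]
    ring
  · change -((Z *ᵥ x0) a + ((1 : Matrix (Idx N q) (Idx N q) ℝ) *ᵥ x1) a + (Z *ᵥ x2) a +
      ((-barL q G) *ᵥ x3) a) - (0 : Idx N q → ℝ) a = (-x1 + barL q G *ᵥ x3) a
    simp only [hZ, zero_mulVec, one_mulVec, neg_mulVec, Pi.add_apply, Pi.neg_apply,
      Pi.zero_apply]
    ring
  · change -((Z *ᵥ x0) a + (Z *ᵥ x1) a + (Z *ᵥ x2) a + ((-barL q G) *ᵥ x3) a) -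
      (0 : Idx N q → ℝ) a = (barL q G *ᵥ x3) a
    simp only [hZ, zero_mulVec, neg_mulVec, Pi.neg_apply, Pi.zero_apply]
    ring
  · change -(((-B') *ᵥ x0) a + (barL q G *ᵥ x1) a + (barL q G *ᵥ x2) a + (Z *ᵥ x3) a) -
      (0 : Idx N q → ℝ) a = (B' *ᵥ x0 - barL q G *ᵥ x1 - barL q G *ᵥ x2) a
    simp only [hZ, zero_mulVec, neg_mulVec, Pi.sub_apply, Pi.neg_apply, Pi.zero_apply]
    ring

theorem exists_lipschitzWith_field (G : SimpleGraph (Fin N)) [DecidableRel G.Adj] (γ : ℝ)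
    (P : Matrix X X ℝ) (d : X → ℝ) (Φ : Matrix X (Fin q) ℝ) (r : Fin N → X → ℝ) :
    ∃ K, LipschitzWith K (field G γ P d Φ r) := by
  have h := (LinearMap.toContinuousLinearMap
    (Matrix.toEuclideanLin (matA G γ P d Φ))).lipschitz.neg.sub
      (LipschitzWith.const (WithLp.toLp 2 (vecB d Φ r)))
  exact ⟨_, h⟩

/-- The point `(θ̄*, 0, μ̄, w̄*)` is a zero of the field when `μ̄ ∈ 𝓕`. -/
theorem field_eq_zero (G : SimpleGraph (Fin N)) [DecidableRel G.Adj] (γ : ℝ)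
    (P : Matrix X X ℝ) {d : X → ℝ} (hd : ∀ s, 0 < d s) {Φ : Matrix X (Fin q) ℝ}
    (hΦ : Φ.rank = q) (r : Fin N → X → ℝ) (w : Fin q → ℝ) {μ : Idx N q → ℝ}
    (hμ : μ ∈ setF G γ P d Φ (thetaStar γ P d Φ r w)) :
    field G γ P d Φ r (WithLp.toLp 2 fun p =>
      (![thetaStar γ P d Φ r w, 0, μ, stack N w] : Fin 4 → Idx N q → ℝ) p.1 p.2) = 0 := by
  rw [field_eq_saddleField]
  have hdet := (Matrix.isUnit_iff_isUnit_det _).1 (posDef_gram (N := N) hd hΦ).isUnit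
  -- The first block row of `Ax + b = 0`, obtained by cancelling the invertible Gram matrix in the
  -- definition of `θ̄*`.
  have hθ : ((barΦ N Φ)ᵀ * barD N d * barΦ N Φ) *ᵥ thetaStar γ P d Φ r w =
      ((barΦ N Φ)ᵀ * barD N d) *ᵥ barR r - barB N γ P d Φ *ᵥ stack N w := by
    have hB : barB N γ P d Φ *ᵥ stack N w = ((barΦ N Φ)ᵀ * barD N d) *ᵥ
        (barΦ N Φ *ᵥ stack N w - γ • (barP N P *ᵥ (barΦ N Φ *ᵥ stack N w))) := by
      rw [barB, ← mulVec_mulVec, ← mulVec_mulVec, sub_mulVec, one_mulVec, smul_mulVec]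
    rw [thetaStar, mulVec_mulVec, mul_nonsing_inv _ hdet, one_mulVec, hB, ← mulVec_sub]
    congr 1
    abel
  have hμ' : barL q G *ᵥ μ = (barB N γ P d Φ)ᵀ *ᵥ thetaStar γ P d Φ r w := by
    rw [transpose_barB]; exact hμ
  set e : Space N q := WithLp.toLp 2 fun p =>
      (![thetaStar γ P d Φ r w, 0, μ, stack N w] : Fin 4 → Idx N q → ℝ) p.1 p.2
  have e0 : stackedBlock e 0 = thetaStar γ P d Φ r w := rfl
  have e1 : stackedBlock e 1 = 0 := rfl
  have e2 : stackedBlock e 2 = μ := rfl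
  have e3 : stackedBlock e 3 = stack N w := rfl
  rw [saddleField, e0, e1, e2, e3, hθ, hμ', barL_mulVec_stack, mulVec_zero]
  ext ⟨k, a⟩
  fin_cases k <;> simp

end DGTD

/-! ### The stability theorem -/

theorem mainTheorem6
    {N q : ℕ} {S A : Fin N → Type*} [∀ i, Fintype (S i)] [∀ i, DecidableEq (S i)]
    [∀ i, Fintype (A i)]
    (M : MultiAgentMDP N S A) (π : LocalPolicies N S A)
    (G : SimpleGraph (Fin N)) [DecidableRel G.Adj] (hG : G.Connected)
    (hergodic : (M.transitionMatrix π).IsPrimitive)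
    (d : (∀ i, S i) → ℝ) (hd_pos : ∀ s, 0 < d s) (hd_sum : ∑ s, d s = 1)
    (hd_stationary : d ᵥ* M.transitionMatrix π = d)
    (Φ : Matrix (∀ i, S i) (Fin q) ℝ) (hΦ : Φ.rank = q)
    (wstar : Fin q → ℝ)
    (hwstar : DGTD.SolvesProjectedBellman M.γ (M.transitionMatrix π) d Φ
      (M.expectedReward π) wstar)
    (lθ uθ lv uv lμ uμ lw uw : DGTD.Idx N q → ℝ)
    (hCv_nondegenerate : ∀ a, lv a < uv a)
    (hCθ : DGTD.thetaStar M.γ (M.transitionMatrix π) d Φ (M.expectedReward π) wstar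
      ∈ Set.Icc lθ uθ)
    (hCv : (0 : DGTD.Idx N q → ℝ) ∈ Set.Icc lv uv)
    (hCμ : (Set.Icc lμ uμ ∩ DGTD.setF G M.γ (M.transitionMatrix π) d Φ
      (DGTD.thetaStar M.γ (M.transitionMatrix π) d Φ (M.expectedReward π) wstar)).Nonempty)
    (hCw : DGTD.stack N wstar ∈ Set.Icc lw uw) :
    IsGloballyAsymptoticallyStable
      (DGTD.constraintSet (Set.Icc lθ uθ) (Set.Icc lv uv) (Set.Icc lμ uμ) (Set.Icc lw uw))
      (DGTD.field G M.γ (M.transitionMatrix π) d Φ (M.expectedReward π))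
      (stationarySet
        (DGTD.constraintSet (Set.Icc lθ uθ) (Set.Icc lv uv) (Set.Icc lμ uμ) (Set.Icc lw uw))
        (DGTD.field G M.γ (M.transitionMatrix π) d Φ (M.expectedReward π))) := by
  rw [DGTD.constraintSet_Icc_eq]
  set l : Fin 4 × DGTD.Idx N q → ℝ := fun p => (![lθ, lv, lμ, lw] : Fin 4 → _) p.1 p.2
  set u : Fin 4 × DGTD.Idx N q → ℝ := fun p => (![uθ, uv, uμ, uw] : Fin 4 → _) p.1 p.2
  obtain ⟨μ, hμ, hμF⟩ := hCμ
  obtain ⟨K, hK⟩ := DGTD.exists_lipschitzWith_field G M.γ (M.transitionMatrix π) d Φ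
    (M.expectedReward π)
  have hzero := DGTD.field_eq_zero G M.γ (M.transitionMatrix π) hd_pos hΦ (M.expectedReward π)
    wstar hμF
  set e : DGTD.Space N q := WithLp.toLp 2 fun p =>
    (![DGTD.thetaStar M.γ (M.transitionMatrix π) d Φ (M.expectedReward π) wstar, 0, μ,
      DGTD.stack N wstar] : Fin 4 → DGTD.Idx N q → ℝ) p.1 p.2
  have heC : e ∈ euclideanBox l u := by
    rintro ⟨k, a⟩
    fin_cases k
    exacts [⟨hCθ.1 a, hCθ.2 a⟩, ⟨hCv.1 a, hCv.2 a⟩, ⟨hμ.1 a, hμ.2 a⟩, ⟨hCw.1 a, hCw.2 a⟩]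
  have hG' := DGTD.posDef_gram (N := N) hd_pos hΦ
  have hL := DGTD.transpose_barL (q := q) G
  rw [DGTD.field_eq_saddleField] at hK hzero ⊢
  exact isGloballyAsymptoticallyStable_of_mem_closure hK
    (fun a _ b _ => inner_saddleField_sub_nonpos hL hG' a b)
    ⟨e, mem_stationarySet_of_eq_zero heC hzero⟩ fun x hx =>
      exists_stationary_mem_closure_saddleField hL hG' hK hCv_nondegenerate heC hzero
        (fun _ => rfl) hx
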